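/- Let $G\subset O(n)$ be a closed subgroup with no nonzero fixed points, i.e. $gx=x$ for all $g\in G$ implies $x=0$. Let $K\subset\mathbb R^n$ be a convex body (a compact convex set with nonempty interior) that is $G$-invariant, i.e. $gK=K$ for all $g\in G$, and let $0<q\le n$. Then the origin lies in the interior of $K$. For a Borel set $\eta\subset S^{n-1}$ let $$\widetilde C_q(K,\eta)=\frac1n\int_{\alpha_K^*(\eta)}\rho_K(u)^q\,d\mathcal H^{n-1}(u)$$ be the $q$-th dual curvature measure of $K$, where $\rho_K(u)=\max\{c: cu\in K\}$ is the radial function of $K$ and $\alpha_K^*(\eta)$ is the set of all $u\in S^{n-1}$ such that the boundary point $\rho_K(u)u$ of $K$ has an outer unit normal vector in $\eta$. Then $\widetilde C_q(K,S^{n-1})>0$, and for every $G$-invariant linear subspace $L$ of $\mathbb R^n$ (i.e. $gL=L$ for all $g\in G$) with $L\neq\{0\}$ and $L\neq\mathbb R^n$, $$\frac{\widetilde C_q(K,S^{n-1}\cap L)}{\widetilde C_q(K,S^{n-1})}\le\min\left\{\frac{\dim L}{q},1\right\}.$$ Moreover, if $q<n$, then this inequality is strict. -/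

import Mathlib

open MeasureTheory

noncomputable section

/-- The action of an orthogonal matrix on Euclidean space `ℝⁿ`. -/
def orthAct {n : ℕ} (g : Matrix.orthogonalGroup (Fin n) ℝ) :
    EuclideanSpace ℝ (Fin n) →ₗ[ℝ] EuclideanSpace ℝ (Fin n) :=
  Matrix.toEuclideanLin (g : Matrix (Fin n) (Fin n) ℝ)

/-- `G ⊂ O(n)` has no nonzero fixed points: `Fix(G) = {0}`. -/
def NoNonzeroFixedPoints {n : ℕ} (G : Subgroup (Matrix.orthogonalGroup (Fin n) ℝ)) : Prop :=
  ∀ x : EuclideanSpace ℝ (Fin n), (∀ g ∈ G, orthAct g x = x) → x = 0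

/-- A `G`-invariant set: `gK = K` for all `g ∈ G`. -/
def IsInvariantSet {n : ℕ} (G : Subgroup (Matrix.orthogonalGroup (Fin n) ℝ))
    (K : Set (EuclideanSpace ℝ (Fin n))) : Prop :=
  ∀ g ∈ G, orthAct g '' K = K

/-- A `G`-invariant linear subspace: `gL = L` for all `g ∈ G`. -/
def IsInvariantSubspace {n : ℕ} (G : Subgroup (Matrix.orthogonalGroup (Fin n) ℝ))
    (L : Submodule ℝ (EuclideanSpace ℝ (Fin n))) : Prop :=
  ∀ g ∈ G, L.map (orthAct g) = L

/-- A convex body of `ℝⁿ`: a compact convex set with nonempty interior. -/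
structure IsConvexBody {n : ℕ} (K : Set (EuclideanSpace ℝ (Fin n))) : Prop where
  convex : Convex ℝ K
  isCompact : IsCompact K
  interior_nonempty : (interior K).Nonempty

/-- The radial function `ρ_K(x) = max {c : c x ∈ K}`. The supremum is a maximum when `K` is
a convex body with the origin in its interior and `x ≠ 0`. -/
def radialFun {n : ℕ} (K : Set (EuclideanSpace ℝ (Fin n)))
    (x : EuclideanSpace ℝ (Fin n)) : ℝ :=
  sSup {c : ℝ | c • x ∈ K}

/-- `ν_K⁻¹(η)`: the boundary points of `K` that have an outer unit normal vector in
`η ⊂ S^{n-1}`. -/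
def reverseSphericalImage {n : ℕ} (K : Set (EuclideanSpace ℝ (Fin n)))
    (η : Set (Metric.sphere (0 : EuclideanSpace ℝ (Fin n)) 1)) :
    Set (EuclideanSpace ℝ (Fin n)) :=
  {x | x ∈ frontier K ∧ ∃ v ∈ η, ∀ y ∈ K,
    inner ℝ y (v : EuclideanSpace ℝ (Fin n)) ≤ inner ℝ x (v : EuclideanSpace ℝ (Fin n))}

/-- `α_K^*(η) = {u ∈ S^{n-1} : ρ_K(u) u ∈ ν_K⁻¹(η)}`. -/
def reverseRadialGaussImage {n : ℕ} (K : Set (EuclideanSpace ℝ (Fin n)))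
    (η : Set (Metric.sphere (0 : EuclideanSpace ℝ (Fin n)) 1)) :
    Set (Metric.sphere (0 : EuclideanSpace ℝ (Fin n)) 1) :=
  {u | radialFun K u • (u : EuclideanSpace ℝ (Fin n)) ∈ reverseSphericalImage K η}

/-- The `q`-th dual curvature measure of a convex body `K` with the origin in its interior,
`C̃_q(K, η) = (1/n) ∫_{α_K^*(η)} ρ_K(u)^q du`, for Borel sets `η ⊂ S^{n-1}`. Here `du` is
the spherical Lebesgue measure, that is, `(n-1)`-dimensional Hausdorff measure on `S^{n-1}`
in its usual normalization (total mass `n` times the volume of the unit ball). -/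
def dualCurvature {n : ℕ} (q : ℝ) (K : Set (EuclideanSpace ℝ (Fin n)))
    (η : Set (Metric.sphere (0 : EuclideanSpace ℝ (Fin n)) 1)) : ℝ :=
  (1 / (n : ℝ)) * ∫ u in reverseRadialGaussImage K η,
    radialFun K (u : EuclideanSpace ℝ (Fin n)) ^ q
      ∂((volume : Measure (EuclideanSpace ℝ (Fin n))).toSphere)

/-- The great subsphere `S^{n-1} ∩ L` of a linear subspace `L`, as a subset of `S^{n-1}`. -/
def subsphere {n : ℕ} (L : Submodule ℝ (EuclideanSpace ℝ (Fin n))) :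
    Set (Metric.sphere (0 : EuclideanSpace ℝ (Fin n)) 1) :=
  {u | (u : EuclideanSpace ℝ (Fin n)) ∈ L}

end

/-!
Write `k = dim L` and `p = q - n ≤ 0`. In polar coordinates, the dual curvature measure of
`S^{n-1} ∩ L` is, up to the factor `q / n`, the integral of `‖x‖ ^ p` over the part of `K` lying in
the cone `D` over the boundary points with an outer normal in `L` (`setLIntegral_radialFun_rpow`),
and its total mass is the corresponding integral over all of `K`. Both integrals are computed by
integrating first over the fibres parallel to `Lᗮ` (`fiberIntegral`) and then, in polar
coordinates, over the projection `M` of `K` to `L`.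

Let `w` be a unit vector of `L` and `R w` the corresponding boundary point of `M`. Over `R w` every
point of `D` lies in `K` (`mem_of_mem_normalCone`), so the fibre integral of `K` is at least that of
`D`. The fibre integrals of the cone `D` are homogeneous of degree `q - k`
(`fiberIntegral_smul_of_cone`), so `D` contributes `∫ r ^ (q - 1)`, that is `R ^ q / q` up to a
factor depending on `w`. The fibre integrals of `K` do not decrease from `R w` towards the origin
(`mul_fiberIntegral_le_fiberIntegral_smul`), so `K` contributes at least `∫ r ^ (k - 1)` times the
value at `R w`, that is `R ^ q / k` up to the same factor. Comparing the two gives the ratio `k / q`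
(`exists_mul_lintegral_normalCone_le`).

The monotonicity of the fibre integrals is where the group enters. By the Brunn–Minkowski
inequality, which is derived from the Prékopa–Leindler inequality, the volume of the fibres of an
invariant convex set is a quasi-concave function of the base point, and it is invariant under `G`.
Its superlevel sets are therefore convex and invariant, and a nonempty convex invariant set contains
the origin because `G` is compact and fixes no other point (`zero_mem_of_convex_invariant`); this
also puts the origin in the interior of `K`. Hence the fibres grow towards the origin
(`volume_fiber_le_volume_fiber_smul`), and the same holds for the intersection of `K` with each
superlevel set of a weight depending only on the distance to `L`. For `p < 0` the weight `‖x‖ ^ p`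
in addition grows by a uniform factor when the component in `L` is halved
(`mul_fiberIntegral_le_fiberIntegral_smul_of_le_half`), which gives strict inequality. The bound by
`1` is always strict, since directions orthogonal to `L` do not belong to the closed cone `D`.
-/

open MeasureTheory
open scoped ENNReal Pointwise RealInnerProductSpace

/-! ### The Prékopa–Leindler inequality -/

/-- The one-dimensional Brunn–Minkowski inequality. -/
theorem Real.volume_add_volume_le_volume_add {A B : Set ℝ} (hA : MeasurableSet A)
    (hB : MeasurableSet B) (hA0 : A.Nonempty) (hB0 : B.Nonempty) :
    volume A + volume B ≤ volume (A + B) := by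
  by_contra! hlt
  rcases eq_or_ne (volume A) 0 with h0 | h0
  · obtain ⟨a, ha⟩ := hA0
    rw [h0, zero_add] at hlt
    refine absurd hlt (not_lt.2 ?_)
    calc volume B = volume ((fun x => a + x) '' B) := by simp
      _ ≤ volume (A + B) := measure_mono (by
        rintro _ ⟨x, hx, rfl⟩
        exact Set.add_mem_add ha hx)
  rcases eq_or_ne (volume B) 0 with h1 | h1
  · obtain ⟨b, hb⟩ := hB0
    rw [h1, add_zero] at hlt
    refine absurd hlt (not_lt.2 ?_)
    calc volume A = volume ((fun x => x + b) '' A) := by simp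
      _ ≤ volume (A + B) := measure_mono (by
        rintro _ ⟨x, hx, rfl⟩
        exact Set.add_mem_add hx hb)
  obtain ⟨y, hy, z, hz, hyz⟩ := ENNReal.exists_lt_add_of_lt_add hlt h0 h1
  obtain ⟨S, hSA, hS, hyS⟩ := hA.exists_lt_isCompact hy
  obtain ⟨T, hTB, hT, hzT⟩ := hB.exists_lt_isCompact hz
  have hS0 : S.Nonempty := nonempty_of_measure_ne_zero (ne_bot_of_gt hyS)
  have hT0 : T.Nonempty := nonempty_of_measure_ne_zero (ne_bot_of_gt hzT)
  obtain ⟨a, haS, ha⟩ := hS.exists_isGreatest hS0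
  obtain ⟨b, hbT, hb⟩ := hT.exists_isLeast hT0
  -- the translates `S + b` and `a + T` of `S` and `T` only share the point `a + b`
  have hdisj : AEDisjoint volume ((fun x => x + b) '' S) ((fun x => a + x) '' T) := by
    refine measure_mono_null (t := {a + b}) ?_ (by simp)
    rintro _ ⟨⟨x, hx, rfl⟩, ⟨y, hy, hxy⟩⟩
    have := ha hx
    have := hb hy
    simp only [Set.mem_singleton_iff] at *
    linarith
  have hle : volume S + volume T ≤ volume (A + B) := by
    calc volume S + volume T
        = volume ((fun x => x + b) '' S) + volume ((fun x => a + x) '' T) := by simp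
      _ = volume ((fun x => x + b) '' S ∪ (fun x => a + x) '' T) :=
        (measure_union₀ (hT.image (by fun_prop)).measurableSet.nullMeasurableSet hdisj).symm
      _ ≤ volume (A + B) := measure_mono (by
        rintro _ (⟨x, hx, rfl⟩ | ⟨x, hx, rfl⟩)
        · exact Set.add_mem_add (hSA hx) (hTB hbT)
        · exact Set.add_mem_add (hSA haS) (hTB hx))
  exact absurd (hyz.trans (ENNReal.add_lt_add hyS hzT)) (not_lt.2 hle)

/-- A Prékopa–Leindler inequality in dimension one for functions with the same supremum: since all
nonempty superlevel sets are compared by the Brunn–Minkowski inequality, the arithmetic mean of the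
integrals appears. -/
theorem lintegral_add_lintegral_le_of_superlevel {a b : ℝ} (ha : 0 < a) (hb : 0 < b)
    {f g h : ℝ → ℝ} (hf : Measurable f) (hg : Measurable g) (hh : Measurable h)
    (hf0 : ∀ x, 0 ≤ f x) (hg0 : ∀ x, 0 ≤ g x) (hh0 : ∀ x, 0 ≤ h x)
    (hf1 : ∀ x, f x ≤ 1) (hg1 : ∀ x, g x ≤ 1)
    (hfs : ∀ t < 1, ∃ x, t < f x) (hgs : ∀ t < 1, ∃ x, t < g x)
    (H : ∀ x y t, 0 ≤ t → t < f x → t < g y → t < h (a * x + b * y)) :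
    ENNReal.ofReal a * (∫⁻ x, ENNReal.ofReal (f x)) +
        ENNReal.ofReal b * (∫⁻ x, ENNReal.ofReal (g x)) ≤ ∫⁻ x, ENNReal.ofReal (h x) := by
  rw [lintegral_eq_lintegral_meas_lt _ (.of_forall hf0) hf.aemeasurable,
    lintegral_eq_lintegral_meas_lt _ (.of_forall hg0) hg.aemeasurable,
    lintegral_eq_lintegral_meas_lt _ (.of_forall hh0) hh.aemeasurable,
    ← lintegral_const_mul' _ _ ENNReal.ofReal_ne_top,
    ← lintegral_const_mul' _ _ ENNReal.ofReal_ne_top, ← lintegral_add_left']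
  · refine setLIntegral_mono' measurableSet_Ioi fun t (ht : 0 < t) => ?_
    rcases le_or_gt 1 t with h1 | h1
    · have e1 : {x | t < f x} = ∅ := by
        ext x; simpa using (hf1 x).trans h1
      have e2 : {x | t < g x} = ∅ := by
        ext x; simpa using (hg1 x).trans h1
      simp [e1, e2]
    · have key : ∀ (c : ℝ), 0 < c → ∀ s : Set ℝ,
          ENNReal.ofReal c * volume s = volume (c • s) := fun c hc s => by
        rw [Measure.addHaar_smul]; simp [abs_of_pos hc]
      rw [key a ha, key b hb]
      refine (Real.volume_add_volume_le_volume_add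
        ((measurableSet_lt measurable_const hf).const_smul_of_ne_zero ha.ne')
        ((measurableSet_lt measurable_const hg).const_smul_of_ne_zero hb.ne')
        (Set.Nonempty.smul_set (hfs t h1)) (Set.Nonempty.smul_set (hgs t h1))).trans
        (measure_mono ?_)
      rintro _ ⟨_, ⟨x, hx, rfl⟩, _, ⟨y, hy, rfl⟩, rfl⟩
      exact H x y t ht.le hx hy
  · refine (Measurable.const_mul ?_ _).aemeasurable
    exact Antitone.measurable fun s t hst => measure_mono fun x (hx : t < f x) => hst.trans_lt hx

theorem ENNReal.geom_mean_le_arith_mean2_weighted {a b : ℝ} (ha : 0 < a) (hb : 0 < b)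
    (hab : a + b = 1) (x y : ℝ≥0∞) :
    x ^ a * y ^ b ≤ ENNReal.ofReal a * x + ENNReal.ofReal b * y := by
  rcases eq_or_ne x ∞ with rfl | hx
  · simp [ENNReal.mul_top, ha]
  rcases eq_or_ne y ∞ with rfl | hy
  · simp [ENNReal.mul_top, hb]
  lift x to NNReal using hx
  lift y to NNReal using hy
  rw [← ENNReal.coe_rpow_of_nonneg _ ha.le, ← ENNReal.coe_rpow_of_nonneg _ hb.le,
    ENNReal.ofReal, ENNReal.ofReal]
  norm_cast
  have := NNReal.geom_mean_le_arith_mean2_weighted (a.toNNReal) (b.toNNReal) x y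
    (by rw [← Real.toNNReal_add ha.le hb.le, hab, Real.toNNReal_one])
  simpa [Real.coe_toNNReal _ ha.le, Real.coe_toNNReal _ hb.le] using this

theorem prekopa_leindler_real_of_bdd {a b : ℝ} (ha : 0 < a) (hb : 0 < b) (hab : a + b = 1)
    {f g h : ℝ → ℝ≥0∞} (hf : Measurable f) (hg : Measurable g) (hh : Measurable h)
    (hfb : ⨆ x, f x ≠ ∞) (hgb : ⨆ x, g x ≠ ∞)
    (H : ∀ x y, f x ^ a * g y ^ b ≤ h (a * x + b * y)) :
    (∫⁻ x, f x) ^ a * (∫⁻ x, g x) ^ b ≤ ∫⁻ x, h x := by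
  set F := ⨆ x, f x with hF
  set G := ⨆ x, g x with hG
  have hfF : ∀ x, f x ≤ F := fun x => le_iSup f x
  have hgG : ∀ x, g x ≤ G := fun x => le_iSup g x
  rcases eq_or_ne F 0 with hF0 | hF0
  · have : ∀ x, f x = 0 := fun x => le_antisymm ((hfF x).trans hF0.le) bot_le
    simp [this, ha]
  rcases eq_or_ne G 0 with hG0 | hG0
  · have : ∀ x, g x = 0 := fun x => le_antisymm ((hgG x).trans hG0.le) bot_le
    simp [this, hb]
  set M := F ^ a * G ^ b with hM
  have hM0 : M ≠ 0 := mul_ne_zero (by simp [hF0, hfb]) (by simp [hG0, hgb])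
  have hMt : M ≠ ∞ := ENNReal.mul_ne_top (ENNReal.rpow_ne_top_of_nonneg ha.le hfb)
    (ENNReal.rpow_ne_top_of_nonneg hb.le hgb)
  have hf1 : ∀ x, f x / F ≤ 1 := fun x => ENNReal.div_le_of_le_mul (by simpa using hfF x)
  have hg1 : ∀ x, g x / G ≤ 1 := fun x => ENNReal.div_le_of_le_mul (by simpa using hgG x)
  have hfe : ∀ x, ENNReal.ofReal (f x / F).toReal = f x / F := fun x =>
    ENNReal.ofReal_toReal (ne_top_of_le_ne_top ENNReal.one_ne_top (hf1 x))
  have hge : ∀ x, ENNReal.ofReal (g x / G).toReal = g x / G := fun x =>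
    ENNReal.ofReal_toReal (ne_top_of_le_ne_top ENNReal.one_ne_top (hg1 x))
  have hhe : ∀ x, ENNReal.ofReal (min (h x / M) 1).toReal = min (h x / M) 1 := fun x =>
    ENNReal.ofReal_toReal (ne_top_of_le_ne_top ENNReal.one_ne_top (min_le_right _ _))
  have sup : ∀ (k : ℝ → ℝ≥0∞) (S : ℝ≥0∞), S = ⨆ x, k x → S ≠ 0 → S ≠ ∞ →
      (∀ x, k x / S ≤ 1) → ∀ t < (1 : ℝ), ∃ x, t < (k x / S).toReal := by
    intro k S hS h0 h1 hk t ht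
    rcases lt_or_ge t 0 with ht0 | ht0
    · exact ⟨0, ht0.trans_le ENNReal.toReal_nonneg⟩
    have : ENNReal.ofReal t * S < ⨆ x, k x := by
      rw [← hS]
      calc ENNReal.ofReal t * S < 1 * S :=
            ENNReal.mul_lt_mul_left h0 h1 (by simpa using ht)
        _ = S := one_mul _
    obtain ⟨x, hx⟩ := lt_iSup_iff.1 this
    refine ⟨x, ?_⟩
    rw [← ENNReal.ofReal_lt_iff_lt_toReal ht0
      (ne_top_of_le_ne_top ENNReal.one_ne_top (hk x))]
    exact (ENNReal.lt_div_iff_mul_lt (.inl h0) (.inl h1)).2 hx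
  have key := lintegral_add_lintegral_le_of_superlevel ha hb
    (f := fun x => (f x / F).toReal) (g := fun x => (g x / G).toReal)
    (h := fun x => (min (h x / M) 1).toReal)
    (hf.div_const _).ennreal_toReal (hg.div_const _).ennreal_toReal
    ((hh.div_const _).min measurable_const).ennreal_toReal
    (fun _ => ENNReal.toReal_nonneg) (fun _ => ENNReal.toReal_nonneg)
    (fun _ => ENNReal.toReal_nonneg)
    (fun x => ENNReal.toReal_le_of_le_ofReal zero_le_one (by simpa using hf1 x))
    (fun x => ENNReal.toReal_le_of_le_ofReal zero_le_one (by simpa using hg1 x))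
    (sup f F hF hF0 hfb hf1) (sup g G hG hG0 hgb hg1) (by
      intro x y t ht htf htg
      rw [← ENNReal.ofReal_lt_iff_lt_toReal ht
        (ne_top_of_le_ne_top ENNReal.one_ne_top (hf1 x))] at htf
      rw [← ENNReal.ofReal_lt_iff_lt_toReal ht
        (ne_top_of_le_ne_top ENNReal.one_ne_top (hg1 y))] at htg
      rw [← ENNReal.ofReal_lt_iff_lt_toReal ht
        (ne_top_of_le_ne_top ENNReal.one_ne_top (min_le_right _ _))]
      refine lt_min ?_ (htf.trans_le (hf1 x))
      calc ENNReal.ofReal t = ENNReal.ofReal t ^ a * ENNReal.ofReal t ^ b := by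
            rw [← ENNReal.rpow_add_of_nonneg _ _ ha.le hb.le, hab, ENNReal.rpow_one]
        _ < (f x / F) ^ a * (g y / G) ^ b :=
            ENNReal.mul_lt_mul (ENNReal.rpow_lt_rpow htf ha) (ENNReal.rpow_lt_rpow htg hb)
        _ = (f x ^ a * g y ^ b) / M := by
            rw [ENNReal.div_rpow_of_nonneg _ _ ha.le, ENNReal.div_rpow_of_nonneg _ _ hb.le, hM,
              ENNReal.mul_div_mul_comm]
            · exact .inr (ENNReal.rpow_ne_top_of_nonneg hb.le hgb)
            · exact .inl (ENNReal.rpow_ne_top_of_nonneg ha.le hfb)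
        _ ≤ h (a * x + b * y) / M := by gcongr; exact H x y)
  simp only [hfe, hge, hhe] at key
  have h1 : (∫⁻ x, f x / F) ^ a * (∫⁻ x, g x / G) ^ b ≤ ∫⁻ x, h x / M :=
    (ENNReal.geom_mean_le_arith_mean2_weighted ha hb hab _ _).trans
      (key.trans (lintegral_mono fun x => min_le_left _ _))
  simp only [div_eq_mul_inv] at h1
  rw [lintegral_mul_const' _ _ (by simpa using hF0), lintegral_mul_const' _ _ (by simpa using hG0),
    lintegral_mul_const' _ _ (by simpa using hM0), ← div_eq_mul_inv, ← div_eq_mul_inv,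
    ← div_eq_mul_inv, ENNReal.div_rpow_of_nonneg _ _ ha.le, ENNReal.div_rpow_of_nonneg _ _ hb.le,
    ← ENNReal.mul_div_mul_comm, ← hM] at h1
  · calc _ = (∫⁻ x, f x) ^ a * (∫⁻ x, g x) ^ b / M * M := (ENNReal.div_mul_cancel hM0 hMt).symm
      _ ≤ (∫⁻ x, h x) / M * M := by gcongr
      _ = _ := ENNReal.div_mul_cancel hM0 hMt
  · exact .inr (ENNReal.rpow_ne_top_of_nonneg hb.le hgb)
  · exact .inl (ENNReal.rpow_ne_top_of_nonneg ha.le hfb)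

/-- The Prékopa–Leindler inequality on the line. -/
theorem prekopa_leindler_real {a b : ℝ} (ha : 0 < a) (hb : 0 < b) (hab : a + b = 1)
    {f g h : ℝ → ℝ≥0∞} (hf : Measurable f) (hg : Measurable g) (hh : Measurable h)
    (H : ∀ x y, f x ^ a * g y ^ b ≤ h (a * x + b * y)) :
    (∫⁻ x, f x) ^ a * (∫⁻ x, g x) ^ b ≤ ∫⁻ x, h x := by
  have trunc : ∀ {k : ℝ → ℝ≥0∞}, Measurable k →
      Filter.Tendsto (fun N : ℕ => ∫⁻ x, min (k x) N) Filter.atTop (nhds (∫⁻ x, k x)) := by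
    intro k hk
    refine lintegral_tendsto_of_tendsto_of_monotone
      (fun N => (hk.min measurable_const).aemeasurable) (.of_forall fun x N N' hN => ?_)
      (.of_forall fun x => ?_)
    · exact min_le_min le_rfl (by exact_mod_cast hN)
    · simpa using (tendsto_const_nhds (x := k x)).min ENNReal.tendsto_nat_nhds_top
  have hbdd : ∀ (k : ℝ → ℝ≥0∞) (N : ℕ), ⨆ x, min (k x) (N : ℝ≥0∞) ≠ ∞ := fun k N =>
    ne_top_of_le_ne_top (ENNReal.natCast_ne_top N) (iSup_le fun x => min_le_right _ _)
  have main : ∀ N : ℕ, (∫⁻ x, min (f x) N) ^ a * (∫⁻ x, min (g x) N) ^ b ≤ ∫⁻ x, h x :=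
    fun N => prekopa_leindler_real_of_bdd ha hb hab (hf.min measurable_const)
      (hg.min measurable_const) hh (hbdd f N) (hbdd g N) fun x y =>
        le_trans (by gcongr <;> exact min_le_left _ _) (H x y)
  -- with both integrals nonzero, no product `0 * ∞` spoils the passage to the limit
  rcases eq_or_ne (∫⁻ x, f x) 0 with f0 | f0
  · simp [f0, ha]
  rcases eq_or_ne (∫⁻ x, g x) 0 with g0 | g0
  · simp [g0, hb]
  refine le_of_tendsto (ENNReal.Tendsto.mul ((ENNReal.continuous_rpow_const.tendsto _).comp
    (trunc hf)) (.inl (by simp [f0, ha, ha.le])) ((ENNReal.continuous_rpow_const.tendsto _).comp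
    (trunc hg)) (.inl (by simp [g0, hb, hb.le]))) (.of_forall main)

/-- The Prékopa–Leindler inequality on `ℝᵐ`, by induction on `m` over the slices. -/
theorem prekopa_leindler {a b : ℝ} (ha : 0 < a) (hb : 0 < b) (hab : a + b = 1) (m : ℕ)
    {f g h : (Fin m → ℝ) → ℝ≥0∞} (hf : Measurable f) (hg : Measurable g) (hh : Measurable h)
    (H : ∀ x y, f x ^ a * g y ^ b ≤ h (a • x + b • y)) :
    (∫⁻ x, f x) ^ a * (∫⁻ x, g x) ^ b ≤ ∫⁻ x, h x := by
  induction m with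
  | zero =>
    simp only [lintegral_unique, volume_pi, Measure.pi_univ, Finset.univ_eq_empty,
      Finset.prod_empty, mul_one]
    exact (H _ _).trans_eq (congrArg h (Subsingleton.elim _ _))
  | succ m ih =>
    let e := MeasurableEquiv.piFinSuccAbove (fun _ : Fin (m + 1) => ℝ) 0
    have he : MeasurePreserving e.symm (volume.prod volume) volume :=
      (volume_preserving_piFinSuccAbove (fun _ : Fin (m + 1) => ℝ) 0).symm
    have hsplit : ∀ {k : (Fin (m + 1) → ℝ) → ℝ≥0∞}, Measurable k →
        ∫⁻ x, k x = ∫⁻ s : ℝ, ∫⁻ x : Fin m → ℝ, k (e.symm (s, x)) := fun {k} hk => by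
      rw [← he.lintegral_comp hk,
        lintegral_prod (fun p => k (e.symm p)) (hk.comp e.symm.measurable).aemeasurable]
    have hlin : ∀ (s t : ℝ) (x y : Fin m → ℝ),
        a • e.symm (s, x) + b • e.symm (t, y) = e.symm (a * s + b * t, a • x + b • y) := by
      intro s t x y
      ext i
      refine Fin.cases ?_ (fun j => ?_) i <;>
        simp [e, MeasurableEquiv.piFinSuccAbove, Fin.insertNthEquiv]
    have hmeas : ∀ {k : (Fin (m + 1) → ℝ) → ℝ≥0∞}, Measurable k →
        Measurable fun p : ℝ × (Fin m → ℝ) => k (e.symm p) := fun hk => hk.comp e.symm.measurable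
    rw [hsplit hf, hsplit hg, hsplit hh]
    refine prekopa_leindler_real ha hb hab (hmeas hf).lintegral_prod_right'
      (hmeas hg).lintegral_prod_right' (hmeas hh).lintegral_prod_right' fun s t => ?_
    refine ih ((hmeas hf).comp measurable_prodMk_left) ((hmeas hg).comp measurable_prodMk_left)
      ((hmeas hh).comp measurable_prodMk_left) fun x y => ?_
    exact (H _ _).trans_eq (by rw [hlin])

/-! ### Brunn–Minkowski inequality and compactness -/

/-- A quasi-concave form of the Brunn–Minkowski inequality: a set containing all combinations
`a • x + b • y` of points of `A` and `B` is at least as large as the smaller of `A` and `B`. -/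
theorem MeasureTheory.Measure.min_measure_le_of_convexComb_mem {F : Type*} [NormedAddCommGroup F]
    [NormedSpace ℝ F] [FiniteDimensional ℝ F] [MeasurableSpace F] [BorelSpace F]
    (μ : Measure F) [μ.IsAddHaarMeasure] {A B C : Set F} (hA : MeasurableSet A)
    (hB : MeasurableSet B) (hC : MeasurableSet C) {a b : ℝ} (ha : 0 < a) (hb : 0 < b)
    (hab : a + b = 1) (h : ∀ x ∈ A, ∀ y ∈ B, a • x + b • y ∈ C) :
    min (μ A) (μ B) ≤ μ C := by
  let e : F ≃L[ℝ] (Fin (Module.finrank ℝ F) → ℝ) :=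
    ContinuousLinearEquiv.ofFinrankEq (by simp)
  have he : Measurable e.symm := e.symm.continuous.measurable
  have hHaar : (Measure.map e.symm
      (volume : Measure (Fin (Module.finrank ℝ F) → ℝ))).IsAddHaarMeasure :=
    e.symm.isAddHaarMeasure_map volume
  have hμ := Measure.isAddLeftInvariant_eq_smul μ
    (Measure.map e.symm (volume : Measure (Fin (Module.finrank ℝ F) → ℝ)))
  set c := μ.addHaarScalarFactor
    (Measure.map e.symm (volume : Measure (Fin (Module.finrank ℝ F) → ℝ)))
  have hval : ∀ {S : Set F}, MeasurableSet S → μ S = c * volume (e.symm ⁻¹' S) := fun hS => by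
    rw [hμ, Measure.smul_apply, Measure.map_apply he hS]; rfl
  have hPL := prekopa_leindler ha hb hab (Module.finrank ℝ F)
    (f := (e.symm ⁻¹' A).indicator 1) (g := (e.symm ⁻¹' B).indicator 1)
    (h := (e.symm ⁻¹' C).indicator 1)
    (measurable_one.indicator (he hA)) (measurable_one.indicator (he hB))
    (measurable_one.indicator (he hC)) (by
      intro x y
      by_cases hx : e.symm x ∈ A
      · by_cases hy : e.symm y ∈ B
        · have := h _ hx _ hy
          simp [Set.indicator, hx, hy, this]
        · simp [Set.indicator, hy, hb]
      · simp [Set.indicator, hx, ha])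
  rw [lintegral_indicator_one (he hA), lintegral_indicator_one (he hB),
    lintegral_indicator_one (he hC)] at hPL
  have hmin : min (volume (e.symm ⁻¹' A)) (volume (e.symm ⁻¹' B)) ≤ volume (e.symm ⁻¹' C) := by
    refine le_trans ?_ hPL
    calc _ = min (volume (e.symm ⁻¹' A)) (volume (e.symm ⁻¹' B)) ^ a *
          min (volume (e.symm ⁻¹' A)) (volume (e.symm ⁻¹' B)) ^ b := by
            rw [← ENNReal.rpow_add_of_nonneg _ _ ha.le hb.le, hab, ENNReal.rpow_one]
      _ ≤ _ := by
        gcongr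
        · exact min_le_left _ _
        · exact min_le_right _ _
  rw [hval hA, hval hB, hval hC]
  rcases le_total (volume (e.symm ⁻¹' A)) (volume (e.symm ⁻¹' B)) with hle | hle
  · rw [min_eq_left hle] at hmin
    exact (min_le_left _ _).trans (by gcongr)
  · rw [min_eq_right hle] at hmin
    exact (min_le_right _ _).trans (by gcongr)

/-- In finite dimension the convex hull of a compact set is compact, since by Carathéodory's
theorem it is the continuous image of a product of a simplex and finitely many copies of the set. -/
theorem IsCompact.convexHull_of_finiteDimensional {F : Type*} [NormedAddCommGroup F]
    [NormedSpace ℝ F] [FiniteDimensional ℝ F] {s : Set F} (hs : IsCompact s) :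
    IsCompact (convexHull ℝ s) := by
  rcases s.eq_empty_or_nonempty with rfl | ⟨p, hp⟩
  · simp
  let d := Module.finrank ℝ F + 1
  have hP : IsCompact (stdSimplex ℝ (Fin d) ×ˢ Set.univ.pi fun _ : Fin d => s) :=
    (isCompact_stdSimplex ℝ (Fin d)).prod (isCompact_univ_pi fun _ => hs)
  convert hP.image (f := fun q : (Fin d → ℝ) × (Fin d → F) => ∑ i, q.1 i • q.2 i) (by fun_prop)
    using 1
  ext x
  constructor
  · intro hx
    obtain ⟨ι, _, z, w, hz, hai, hw, hw1, hx⟩ := eq_pos_convex_span_of_mem_convexHull hx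
    have hcard : Fintype.card ι ≤ Fintype.card (Fin d) := by
      rw [Fintype.card_fin]
      exact hai.card_le_finrank_succ.trans (Nat.succ_le_succ (Submodule.finrank_le _))
    obtain ⟨j⟩ := Function.Embedding.nonempty_of_card_le hcard
    refine ⟨(Function.extend j w 0, Function.extend j z fun _ => p),
      ⟨⟨fun i => ?_, ?_⟩, fun i _ => ?_⟩, ?_⟩
    · by_cases hi : ∃ a, j a = i
      · obtain ⟨a, rfl⟩ := hi
        simpa [j.injective.extend_apply] using (hw a).le
      · simp [Function.extend_apply' _ _ _ hi]
    · rw [← hw1]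
      exact (Fintype.sum_of_injective j j.injective w _
        (fun i hi => Function.extend_apply' w (0 : Fin d → ℝ) i hi)
        fun i => (j.injective.extend_apply w (0 : Fin d → ℝ) i).symm).symm
    · by_cases hi : ∃ a, j a = i
      · obtain ⟨a, rfl⟩ := hi
        simpa [j.injective.extend_apply] using hz ⟨a, rfl⟩
      · simpa [Function.extend_apply' _ _ _ hi] using hp
    · rw [← hx]
      refine (Fintype.sum_of_injective j j.injective (fun i => w i • z i) _ (fun i hi => ?_)
        fun i => ?_).symm
      · simp [Function.extend_apply' _ _ i hi]
      · simp [j.injective.extend_apply]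
  · rintro ⟨⟨w, z⟩, ⟨⟨hw0, hw1⟩, hz⟩, rfl⟩
    exact (convex_convexHull ℝ s).sum_mem (fun i _ => hw0 i) hw1
      fun i _ => subset_convexHull ℝ s (hz i trivial)

theorem Matrix.isCompact_orthogonalGroup (n : ℕ) :
    IsCompact (Matrix.orthogonalGroup (Fin n) ℝ : Set (Matrix (Fin n) (Fin n) ℝ)) := by
  refine (isCompact_univ_pi fun _ => isCompact_univ_pi fun _ =>
    isCompact_Icc (a := (-1 : ℝ)) (b := 1)).of_isClosed_subset ?_ fun A hA i _ j _ => ?_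
  · have : (Matrix.orthogonalGroup (Fin n) ℝ : Set (Matrix (Fin n) (Fin n) ℝ)) =
        {A | A * star A = 1} := by
      ext A; exact Matrix.mem_orthogonalGroup_iff (Fin n) ℝ
    rw [this]
    exact isClosed_eq (continuous_id.matrix_mul continuous_id.matrix_conjTranspose) continuous_const
  · exact abs_le.1 (entry_norm_bound_of_unitary hA i j)

/-! ### Invariant convex sets and their fibres -/

theorem orthAct_mul {n : ℕ} (g h : Matrix.orthogonalGroup (Fin n) ℝ)
    (x : EuclideanSpace ℝ (Fin n)) : orthAct (g * h) x = orthAct g (orthAct h x) := by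
  ext i
  simp [orthAct, Matrix.toLpLin_apply]

theorem norm_orthAct {n : ℕ} (g : Matrix.orthogonalGroup (Fin n) ℝ)
    (x : EuclideanSpace ℝ (Fin n)) : ‖orthAct g x‖ = ‖x‖ := by
  have h : (star (g : Matrix (Fin n) (Fin n) ℝ)) * g = 1 := Unitary.coe_star_mul_self g
  rw [← sq_eq_sq₀ (norm_nonneg _) (norm_nonneg _), ← real_inner_self_eq_norm_sq,
    ← real_inner_self_eq_norm_sq]
  have h2 := LinearMap.adjoint_inner_left (orthAct g) x (orthAct g x)
  rw [← h2]
  unfold orthAct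
  rw [← Matrix.toEuclideanLin_conjTranspose_eq_adjoint]
  congr 1
  ext i
  rw [Matrix.star_eq_conjTranspose] at h
  simp only [Matrix.toLpLin_apply, Matrix.mulVec_mulVec, h, Matrix.one_mulVec]

/-- The action of an orthogonal matrix, as a linear isometry. -/
noncomputable def orthIsometry {n : ℕ} (g : Matrix.orthogonalGroup (Fin n) ℝ) :
    EuclideanSpace ℝ (Fin n) →ₗᵢ[ℝ] EuclideanSpace ℝ (Fin n) :=
  ⟨orthAct g, norm_orthAct g⟩

/-- A nonempty convex set invariant under a closed group without nonzero fixed points contains the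
origin: the convex hull of an orbit is compact, so it has a unique point of minimal norm, and
uniqueness makes this point a fixed point. -/
theorem zero_mem_of_convex_invariant {n : ℕ} {G : Subgroup (Matrix.orthogonalGroup (Fin n) ℝ)}
    (hG : IsClosed (G : Set (Matrix.orthogonalGroup (Fin n) ℝ))) (hfix : NoNonzeroFixedPoints G)
    {S : Set (EuclideanSpace ℝ (Fin n))} (hS : Convex ℝ S) (hS0 : S.Nonempty)
    (hinv : ∀ g ∈ G, ∀ x ∈ S, orthAct g x ∈ S) : (0 : EuclideanSpace ℝ (Fin n)) ∈ S := by
  obtain ⟨x, hx⟩ := hS0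
  set O := (fun g => orthAct g x) '' (G : Set (Matrix.orthogonalGroup (Fin n) ℝ)) with hO
  have : CompactSpace (Matrix.orthogonalGroup (Fin n) ℝ) :=
    isCompact_iff_compactSpace.1 (Matrix.isCompact_orthogonalGroup n)
  have hcont : Continuous fun g : Matrix.orthogonalGroup (Fin n) ℝ => orthAct g x := by
    unfold orthAct
    simp only [Matrix.toLpLin_apply]
    exact (PiLp.continuous_toLp 2 _).comp
      (continuous_subtype_val.matrix_mulVec continuous_const)
  have hOc : IsCompact O := hG.isCompact.image hcont
  obtain ⟨v, hv, hmin⟩ := hOc.convexHull_of_finiteDimensional.exists_isMinOn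
    (Set.Nonempty.convexHull ⟨_, 1, G.one_mem, rfl⟩) continuous_norm.continuousOn
  have hOS : convexHull ℝ O ⊆ S := convexHull_min (by
    rintro _ ⟨g, hg, rfl⟩
    exact hinv g hg x hx) hS
  have hv0 : v = 0 := hfix v fun g hg => by
    have hgv : orthAct g v ∈ convexHull ℝ O := by
      have h1 : orthAct g v ∈ orthAct g '' convexHull ℝ O := ⟨v, hv, rfl⟩
      rw [LinearMap.image_convexHull] at h1
      refine convexHull_mono ?_ h1
      rintro _ ⟨_, ⟨h, hh, rfl⟩, rfl⟩
      exact ⟨g * h, G.mul_mem hg hh, orthAct_mul g h x⟩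
    by_contra hne
    have hlt := (norm_midpoint_lt_iff (norm_orthAct g v)).2 hne
    rw [norm_orthAct] at hlt
    refine absurd hlt (not_lt.2 (hmin ?_))
    rw [smul_add]
    exact convex_convexHull ℝ O hgv hv (by norm_num) (by norm_num) (by norm_num)
  exact hOS (hv0 ▸ hv)

theorem zero_mem_interior_of_invariant {n : ℕ} {G : Subgroup (Matrix.orthogonalGroup (Fin n) ℝ)}
    (hG : IsClosed (G : Set (Matrix.orthogonalGroup (Fin n) ℝ))) (hfix : NoNonzeroFixedPoints G)
    {K : Set (EuclideanSpace ℝ (Fin n))} (hK : IsConvexBody K) (hKG : IsInvariantSet G K) :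
    (0 : EuclideanSpace ℝ (Fin n)) ∈ interior K := by
  refine zero_mem_of_convex_invariant hG hfix hK.convex.interior hK.interior_nonempty
    fun g hg x hx => ?_
  let e := (orthIsometry g).toLinearIsometryEquiv rfl
  have he : e '' K = K := hKG g hg
  have h1 : e x ∈ e '' interior K := ⟨x, hx, rfl⟩
  have h2 : e '' interior K = interior (e '' K) := e.toHomeomorph.image_interior K
  rwa [h2, he] at h1

theorem LinearIsometry.apply_mem_orthogonal_of_map_eq {E : Type*} [NormedAddCommGroup E]
    [InnerProductSpace ℝ E] (g : E →ₗᵢ[ℝ] E) {L : Submodule ℝ E} (hL : L.map g.toLinearMap = L)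
    {z : E} (hz : z ∈ Lᗮ) : g z ∈ Lᗮ := by
  rw [Submodule.mem_orthogonal] at hz ⊢
  intro u hu
  rw [← hL] at hu
  obtain ⟨u, hu, rfl⟩ := hu
  exact (g.inner_map_map u z).trans (hz u hu)

section Fibers

variable {E : Type*} [NormedAddCommGroup E] [InnerProductSpace ℝ E] [FiniteDimensional ℝ E]
  [MeasurableSpace E] [BorelSpace E]

/-- The fibre of `C` over `x` in the direction `Lᗮ` has the same volume as, hence at most the
volume of, the fibre over `g x`, for a linear isometry `g` preserving `C` and `L`. -/
theorem volume_fiber_le_volume_fiber_apply (g : E →ₗᵢ[ℝ] E) {C : Set E} (hC : ∀ x ∈ C, g x ∈ C)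
    {L : Submodule ℝ E} (hL : L.map g.toLinearMap = L) (x : E) :
    volume {z : Lᗮ | x + z ∈ C} ≤ volume {z : Lᗮ | g x + z ∈ C} := by
  let r : Lᗮ →ₗᵢ[ℝ] Lᗮ := ⟨g.toLinearMap.restrict fun _ => g.apply_mem_orthogonal_of_map_eq hL,
    fun z => g.norm_map z⟩
  let e := r.toLinearIsometryEquiv rfl
  have he : MeasurePreserving e.toHomeomorph.toMeasurableEquiv volume volume := e.measurePreserving
  calc volume {z : Lᗮ | x + z ∈ C}
      ≤ volume (e.toHomeomorph.toMeasurableEquiv ⁻¹' {z : Lᗮ | g x + z ∈ C}) :=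
        measure_mono fun z (hz : x + z ∈ C) =>
          show g x + g z ∈ C from g.map_add x z ▸ hC _ hz
    _ = volume {z : Lᗮ | g x + z ∈ C} := he.measure_preimage_equiv _

/-- Volumes of fibres in the direction `Lᗮ` do not decrease when the base point is moved towards
the origin along a segment. By the Brunn–Minkowski inequality, the set of base points whose fibre
is at least as large as a given one is convex; it is also invariant, so it contains the origin. -/
theorem volume_fiber_le_volume_fiber_smul {Γ : Set (E →ₗᵢ[ℝ] E)}
    (hΓ : ∀ S : Set E, Convex ℝ S → S.Nonempty → (∀ g ∈ Γ, ∀ x ∈ S, g x ∈ S) → (0 : E) ∈ S)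
    {C : Set E} (hCc : Convex ℝ C) (hCm : MeasurableSet C) (hC : ∀ g ∈ Γ, ∀ x ∈ C, g x ∈ C)
    {L : Submodule ℝ E} (hL : ∀ g ∈ Γ, L.map g.toLinearMap = L) (x : E) {r : ℝ} (hr0 : 0 ≤ r)
    (hr1 : r ≤ 1) :
    volume {z : Lᗮ | x + z ∈ C} ≤ volume {z : Lᗮ | r • x + z ∈ C} := by
  let S : Set E := {x' | volume {z : Lᗮ | x + z ∈ C} ≤ volume {z : Lᗮ | x' + z ∈ C}}
  have hmeas : ∀ y : E, MeasurableSet {z : Lᗮ | y + z ∈ C} := fun y =>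
    (show Measurable fun z : Lᗮ => y + (z : E) by fun_prop) hCm
  have hSc : Convex ℝ S := by
    refine convex_iff_forall_pos.2 fun y hy y' hy' a b ha hb hab => ?_
    refine (le_min hy hy').trans (volume.min_measure_le_of_convexComb_mem (hmeas y) (hmeas y')
      (hmeas _) ha hb hab fun z hz z' hz' => ?_)
    have := hCc hz hz' ha.le hb.le hab
    have heq : a • (y + (z : E)) + b • (y' + (z' : E)) =
        a • y + b • y' + ((a • z + b • z' : Lᗮ) : E) := by
      simp only [Submodule.coe_add, Submodule.coe_smul, smul_add]
      abel
    rw [heq] at this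
    exact this
  have hxS : x ∈ S := le_refl (volume {z : Lᗮ | x + z ∈ C})
  have h0 : (0 : E) ∈ S := hΓ S hSc ⟨x, hxS⟩ fun g hg y hy =>
    le_trans hy (volume_fiber_le_volume_fiber_apply g (hC g hg) (hL g hg) y)
  have := hSc hxS h0 hr0 (sub_nonneg.2 hr1) (by ring)
  rw [smul_zero, add_zero] at this
  exact this

/-- Integrated form of the comparison of fibres, for a weight decreasing in the distance to `L`:
each superlevel set of the weight cuts a convex invariant set out of `K`. -/
theorem setLIntegral_fiber_le_setLIntegral_fiber_smul {Γ : Set (E →ₗᵢ[ℝ] E)}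
    (hΓ : ∀ S : Set E, Convex ℝ S → S.Nonempty → (∀ g ∈ Γ, ∀ x ∈ S, g x ∈ S) → (0 : E) ∈ S)
    {K : Set E} (hKc : Convex ℝ K) (hKm : MeasurableSet K) (hK : ∀ g ∈ Γ, ∀ x ∈ K, g x ∈ K)
    {L : Submodule ℝ E} (hL : ∀ g ∈ Γ, L.map g.toLinearMap = L) {φ : ℝ → ℝ}
    (hφ : AntitoneOn φ (Set.Ici 0)) (hφm : Measurable φ) (hφ0 : ∀ a, 0 ≤ φ a) {x : E} (hx : x ∈ L)
    {r : ℝ} (hr0 : 0 ≤ r) (hr1 : r ≤ 1) :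
    ∫⁻ z in {z : Lᗮ | x + z ∈ K}, ENNReal.ofReal (φ ‖z‖) ≤
      ∫⁻ z in {z : Lᗮ | r • x + z ∈ K}, ENNReal.ofReal (φ ‖z‖) := by
  have hm : Measurable fun z : Lᗮ => φ ‖z‖ := hφm.comp measurable_norm
  rw [lintegral_eq_lintegral_meas_lt _ (.of_forall fun _ => hφ0 _) hm.aemeasurable,
    lintegral_eq_lintegral_meas_lt _ (.of_forall fun _ => hφ0 _) hm.aemeasurable]
  refine lintegral_mono fun s => ?_
  rw [Measure.restrict_apply (measurableSet_lt measurable_const hm),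
    Measure.restrict_apply (measurableSet_lt measurable_const hm)]
  let P : E → Lᗮ := Lᗮ.orthogonalProjectionOnto
  have hPx : ∀ y ∈ L, ∀ z : Lᗮ, P (y + z) = z := fun y hy z => by
    have : Lᗮ.orthogonalProjectionOnto y = 0 := by
      rw [Submodule.orthogonalProjectionOnto_eq_zero_iff, Submodule.orthogonal_orthogonal]
      exact hy
    simp [P, this]
  have hset : ∀ y ∈ L, {z : Lᗮ | s < φ ‖z‖} ∩ {z : Lᗮ | y + z ∈ K} =
      {z : Lᗮ | y + z ∈ K ∩ {w | s < φ ‖P w‖}} := fun y hy => by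
    ext z
    simp [hPx y hy z, and_comm]
  rw [hset x hx, hset _ (L.smul_mem r hx)]
  refine volume_fiber_le_volume_fiber_smul hΓ ?_ ?_ ?_ hL x hr0 hr1
  · refine hKc.inter fun w hw w' hw' a b ha hb hab => ?_
    have hle : ‖P (a • w + b • w')‖ ≤ max ‖P w‖ ‖P w'‖ := by
      calc ‖P (a • w + b • w')‖ ≤ a * ‖P w‖ + b * ‖P w'‖ := by
            simp only [P, map_add, map_smul]
            refine (norm_add_le _ _).trans_eq ?_
            rw [norm_smul, norm_smul, Real.norm_of_nonneg ha, Real.norm_of_nonneg hb]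
        _ ≤ a * max ‖P w‖ ‖P w'‖ + b * max ‖P w‖ ‖P w'‖ := by
            gcongr
            · exact le_max_left _ _
            · exact le_max_right _ _
        _ = max ‖P w‖ ‖P w'‖ := by rw [← add_mul, hab, one_mul]
    have hmax : s < φ (max ‖P w‖ ‖P w'‖) := by
      rcases max_choice ‖P w‖ ‖P w'‖ with h | h <;> rw [h] <;> assumption
    exact hmax.trans_le (hφ (norm_nonneg _) (le_max_of_le_left (norm_nonneg _)) hle)
  · exact hKm.inter (measurableSet_lt measurable_const
      (hφm.comp (measurable_norm.comp (Lᗮ.orthogonalProjectionOnto).continuous.measurable)))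
  · rintro g hg w ⟨hwK, hw⟩
    refine ⟨hK g hg w hwK, ?_⟩
    have hPg : ‖P (g w)‖ = ‖P w‖ := by
      have hw' : w - P w ∈ L := by
        have := Lᗮ.sub_starProjection_mem_orthogonal w
        rwa [Submodule.orthogonal_orthogonal] at this
      have hgw : g w = g (w - P w) + g (P w) := by rw [← map_add, sub_add_cancel]
      have hgL : g (w - P w) ∈ L := by
        have : g (w - P w) ∈ L.map g.toLinearMap := ⟨_, hw', rfl⟩
        rwa [hL g hg] at this
      rw [hgw, hPx _ hgL ⟨g (P w), g.apply_mem_orthogonal_of_map_eq (hL g hg) (P w).2⟩]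
      exact g.norm_map _
    simpa only [Set.mem_ofPred_eq, hPg] using hw

end Fibers

/-! ### Polar coordinates and fibre integrals -/

section Polar

variable {E : Type*} [NormedAddCommGroup E] [NormedSpace ℝ E] [FiniteDimensional ℝ E]
  [MeasurableSpace E] [BorelSpace E]

/-- Integration in polar coordinates. -/
theorem MeasureTheory.Measure.lintegral_eq_lintegral_toSphere [Nontrivial E] (μ : Measure E)
    [μ.IsAddHaarMeasure] {f : E → ℝ≥0∞} (hf : Measurable f) :
    ∫⁻ x, f x ∂μ = ∫⁻ u, ∫⁻ r in Set.Ioi (0 : ℝ),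
      ENNReal.ofReal (r ^ (Module.finrank ℝ E - 1)) * f (r • (u : E)) ∂volume ∂μ.toSphere := by
  have hm : Measurable fun p : Metric.sphere (0 : E) 1 × Set.Ioi (0 : ℝ) =>
      f ((p.2 : ℝ) • (p.1 : E)) := hf.comp (by fun_prop)
  calc ∫⁻ x, f x ∂μ = ∫⁻ x : ({(0)}ᶜ : Set E), f x ∂(μ.comap (↑)) := by
        rw [lintegral_subtype_comap (measurableSet_singleton _).compl, restrict_compl_singleton]
    _ = ∫⁻ p, f ((p.2 : ℝ) • (p.1 : E))
          ∂(μ.toSphere.prod (.volumeIoiPow (Module.finrank ℝ E - 1))) := by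
        rw [← μ.measurePreserving_homeomorphUnitSphereProd.lintegral_comp hm]
        refine lintegral_congr fun x => ?_
        have hx : ‖(x : E)‖ ≠ 0 := norm_ne_zero_iff.2 x.2
        simp [smul_smul, hx]
    _ = _ := by
        rw [lintegral_prod _ hm.aemeasurable]
        refine lintegral_congr fun u => ?_
        have hmu : Measurable fun r : ℝ => f (r • (u : E)) := hf.comp (by fun_prop)
        refine (lintegral_withDensity_eq_lintegral_mul _ (by fun_prop)
          (hmu.comp measurable_subtype_coe)).trans ?_
        exact lintegral_subtype_comap measurableSet_Ioi
          fun r : ℝ => ENNReal.ofReal (r ^ (Module.finrank ℝ E - 1)) * f (r • (u : E))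

theorem lintegral_Ioc_rpow {a : ℝ} (ha : 0 < a) {R : ℝ} (hR : 0 ≤ R) :
    ∫⁻ r in Set.Ioc 0 R, ENNReal.ofReal (r ^ (a - 1)) = ENNReal.ofReal (R ^ a / a) := by
  have hint : IntervalIntegrable (fun r : ℝ => r ^ (a - 1)) volume 0 R :=
    intervalIntegral.intervalIntegrable_rpow' (by linarith)
  rw [← ofReal_integral_eq_lintegral_ofReal
      ((intervalIntegrable_iff_integrableOn_Ioc_of_le hR).1 hint),
    ← intervalIntegral.integral_of_le hR, integral_rpow (.inl (by linarith))]
  · simp [ha.ne']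
  · filter_upwards [ae_restrict_mem measurableSet_Ioc] with r hr
    exact Real.rpow_nonneg hr.1.le _

theorem lintegral_comp_smul_of_pos (μ : Measure E) [μ.IsAddHaarMeasure] {f : E → ℝ≥0∞}
    (hf : Measurable f) {r : ℝ} (hr : 0 < r) :
    ∫⁻ x, f x ∂μ = ENNReal.ofReal (r ^ Module.finrank ℝ E) * ∫⁻ x, f (r • x) ∂μ := by
  have h := Measure.map_addHaar_smul μ hr.ne'
  rw [← lintegral_map hf (measurable_const_smul r), h, lintegral_smul_measure, smul_eq_mul,
    ← mul_assoc, ← ENNReal.ofReal_mul (by positivity), abs_of_pos (by positivity),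
    mul_inv_cancel₀ (by positivity), ENNReal.ofReal_one, one_mul]

end Polar

theorem norm_add_sq_of_mem_orthogonal {E : Type*} [NormedAddCommGroup E] [InnerProductSpace ℝ E]
    {L : Submodule ℝ E} {x z : E} (hx : x ∈ L) (hz : z ∈ Lᗮ) :
    ‖x + z‖ ^ 2 = ‖x‖ ^ 2 + ‖z‖ ^ 2 := by
  simpa only [sq] using
    norm_add_sq_eq_norm_sq_add_norm_sq_real (Submodule.inner_right_of_mem_orthogonal hx hz)

theorem norm_add_rpow_of_mem_orthogonal {E : Type*} [NormedAddCommGroup E] [InnerProductSpace ℝ E]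
    {L : Submodule ℝ E} {x z : E} (hx : x ∈ L) (hz : z ∈ Lᗮ) (p : ℝ) :
    ‖x + z‖ ^ p = (‖x‖ ^ 2 + ‖z‖ ^ 2) ^ (p / 2) := by
  rw [← norm_add_sq_of_mem_orthogonal hx hz, ← Real.rpow_natCast, ← Real.rpow_mul (norm_nonneg _)]
  congr 1
  push_cast
  ring

section Splitting

variable {E : Type*} [NormedAddCommGroup E] [InnerProductSpace ℝ E] [FiniteDimensional ℝ E]
  [MeasurableSpace E] [BorelSpace E]

/-- Iterated integration over `L` and `Lᗮ`, up to normalization of the measures. -/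
theorem exists_lintegral_eq_lintegral_orthogonal (L : Submodule ℝ E) :
    ∃ c : NNReal, ∀ f : E → ℝ≥0∞, Measurable f →
      ∫⁻ x, f x = c * ∫⁻ y : L, ∫⁻ z : Lᗮ, f (y + z) := by
  let e : (L × Lᗮ) ≃L[ℝ] E :=
    (Submodule.prodEquivOfIsCompl L Lᗮ L.isCompl_orthogonal).toContinuousLinearEquiv
  let ν : Measure E := (volume.prod volume : Measure (L × Lᗮ)).map e
  have hν : ν.IsAddHaarMeasure := e.isAddHaarMeasure_map _
  have he : Measurable e := e.continuous.measurable
  refine ⟨(volume : Measure E).addHaarScalarFactor ν, fun f hf => ?_⟩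
  conv_lhs => rw [Measure.isAddLeftInvariant_eq_smul (volume : Measure E) ν]
  rw [lintegral_smul_measure, lintegral_map hf he, lintegral_prod (fun q => f (e q))
    (hf.comp he).aemeasurable]
  rfl

/-- The integral of `‖·‖ ^ p` over the fibre of `K` over `x` in the direction `Lᗮ`. -/
noncomputable def fiberIntegral (K : Set E) (L : Submodule ℝ E) (p : ℝ) (x : E) : ℝ≥0∞ :=
  ∫⁻ z : Lᗮ, K.indicator (fun w => ENNReal.ofReal (‖w‖ ^ p)) (x + z)

theorem fiberIntegral_eq_setLIntegral {K : Set E} (hK : MeasurableSet K) {L : Submodule ℝ E}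
    (p : ℝ) {x : E} (hx : x ∈ L) :
    fiberIntegral K L p x = ∫⁻ z in {z : Lᗮ | x + z ∈ K},
      ENNReal.ofReal ((‖x‖ ^ 2 + ‖z‖ ^ 2) ^ (p / 2)) := by
  have hm : MeasurableSet {z : Lᗮ | x + z ∈ K} :=
    (show Measurable fun z : Lᗮ => x + (z : E) by fun_prop) hK
  rw [← lintegral_indicator hm]
  refine lintegral_congr fun z => ?_
  by_cases h : x + (z : E) ∈ K
  · simp [h, norm_add_rpow_of_mem_orthogonal hx z.2]
  · simp [h]

/-- Comparison of the fibre integrals at `x` and `r • x`. Moving towards the origin has two effects: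
the fibres grow in the sense of `setLIntegral_fiber_le_setLIntegral_fiber_smul`, and the weight
grows pointwise, here by a factor of at least `κ`. -/
theorem mul_fiberIntegral_le_fiberIntegral_smul {Γ : Set (E →ₗᵢ[ℝ] E)}
    (hΓ : ∀ S : Set E, Convex ℝ S → S.Nonempty → (∀ g ∈ Γ, ∀ x ∈ S, g x ∈ S) → (0 : E) ∈ S)
    {K : Set E} (hKc : Convex ℝ K) (hKm : MeasurableSet K) (hK : ∀ g ∈ Γ, ∀ x ∈ K, g x ∈ K)
    {L : Submodule ℝ E} (hL : ∀ g ∈ Γ, L.map g.toLinearMap = L) {p : ℝ} (hp : p ≤ 0) {x : E}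
    (hx : x ∈ L) (hx0 : x ≠ 0) {r : ℝ} (hr0 : 0 ≤ r) (hr1 : r ≤ 1) {κ : ℝ} (hκ : 0 ≤ κ)
    (h : ∀ z : Lᗮ, r • x + z ∈ K →
      κ * (‖x‖ ^ 2 + ‖z‖ ^ 2) ^ (p / 2) ≤ (‖r • x‖ ^ 2 + ‖z‖ ^ 2) ^ (p / 2)) :
    ENNReal.ofReal κ * fiberIntegral K L p x ≤ fiberIntegral K L p (r • x) := by
  rw [fiberIntegral_eq_setLIntegral hKm p hx,
    fiberIntegral_eq_setLIntegral hKm p (L.smul_mem r hx)]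
  have hxpos : 0 < ‖x‖ ^ 2 := by positivity
  calc _ ≤ ENNReal.ofReal κ * ∫⁻ z in {z : Lᗮ | r • x + z ∈ K},
        ENNReal.ofReal ((‖x‖ ^ 2 + ‖z‖ ^ 2) ^ (p / 2)) := by
        gcongr ENNReal.ofReal κ * ?_
        refine setLIntegral_fiber_le_setLIntegral_fiber_smul hΓ hKc hKm hK hL
          (φ := fun a => (‖x‖ ^ 2 + a ^ 2) ^ (p / 2)) (fun a ha b hb hab => ?_) (by fun_prop)
          (fun a => by positivity) hx hr0 hr1
        have ha : 0 ≤ a := ha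
        exact Real.rpow_le_rpow_of_nonpos (by positivity) (by gcongr) (by linarith)
    _ = ∫⁻ z in {z : Lᗮ | r • x + z ∈ K},
        ENNReal.ofReal (κ * (‖x‖ ^ 2 + ‖z‖ ^ 2) ^ (p / 2)) := by
        rw [← lintegral_const_mul' _ _ ENNReal.ofReal_ne_top]
        simp_rw [ENNReal.ofReal_mul hκ]
    _ ≤ _ := by
        refine setLIntegral_mono' ?_ fun z hz => ENNReal.ofReal_le_ofReal (h z hz)
        exact (show Measurable fun z : Lᗮ => r • x + (z : E) by fun_prop) hKm

theorem fiberIntegral_le_fiberIntegral_smul {Γ : Set (E →ₗᵢ[ℝ] E)}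
    (hΓ : ∀ S : Set E, Convex ℝ S → S.Nonempty → (∀ g ∈ Γ, ∀ x ∈ S, g x ∈ S) → (0 : E) ∈ S)
    {K : Set E} (hKc : Convex ℝ K) (hKm : MeasurableSet K) (hK : ∀ g ∈ Γ, ∀ x ∈ K, g x ∈ K)
    {L : Submodule ℝ E} (hL : ∀ g ∈ Γ, L.map g.toLinearMap = L) {p : ℝ} (hp : p ≤ 0) {x : E}
    (hx : x ∈ L) (hx0 : x ≠ 0) {r : ℝ} (hr0 : 0 < r) (hr1 : r ≤ 1) :
    fiberIntegral K L p x ≤ fiberIntegral K L p (r • x) := by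
  have := mul_fiberIntegral_le_fiberIntegral_smul hΓ hKc hKm hK hL hp hx hx0 hr0.le hr1
    zero_le_one fun z _ => by
      have : 0 < ‖r • x‖ := norm_pos_iff.2 (smul_ne_zero hr0.ne' hx0)
      have hle : ‖r • x‖ ≤ ‖x‖ := by
        rw [norm_smul, Real.norm_of_nonneg hr0.le]
        exact mul_le_of_le_one_left (norm_nonneg _) hr1
      rw [one_mul]
      exact Real.rpow_le_rpow_of_nonpos (by positivity) (by gcongr) (by linarith)
  simpa using this

/-- For `r ≤ 1 / 2` the fibre integral grows by a uniform factor, which exceeds `1` if `p < 0`. -/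
theorem mul_fiberIntegral_le_fiberIntegral_smul_of_le_half {Γ : Set (E →ₗᵢ[ℝ] E)}
    (hΓ : ∀ S : Set E, Convex ℝ S → S.Nonempty → (∀ g ∈ Γ, ∀ x ∈ S, g x ∈ S) → (0 : E) ∈ S)
    {K : Set E} (hKc : Convex ℝ K) (hKm : MeasurableSet K) (hK : ∀ g ∈ Γ, ∀ x ∈ K, g x ∈ K)
    {L : Submodule ℝ E} (hL : ∀ g ∈ Γ, L.map g.toLinearMap = L) {p : ℝ} (hp : p ≤ 0) {x : E}
    (hx : x ∈ L) {ε T : ℝ} (hε : 0 < ε) (hεx : ε ≤ ‖x‖) (hxT : ‖x‖ ≤ T)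
    (hKT : ∀ y ∈ K, ‖y‖ ≤ T) {r : ℝ} (hr0 : 0 < r) (hr1 : r ≤ 1 / 2) :
    ENNReal.ofReal ((1 - 3 / 8 * (ε / T) ^ 2) ^ (p / 2)) * fiberIntegral K L p x ≤
      fiberIntegral K L p (r • x) := by
  have hT : 0 < T := hε.trans_le (hεx.trans hxT)
  have hεT : (ε / T) ^ 2 ≤ 1 := by
    rw [sq_le_one_iff₀ (by positivity), div_le_one hT]
    exact hεx.trans hxT
  have hbase : 0 < 1 - 3 / 8 * (ε / T) ^ 2 := by linarith
  have hx0 : x ≠ 0 := norm_pos_iff.1 (hε.trans_le hεx)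
  refine mul_fiberIntegral_le_fiberIntegral_smul hΓ hKc hKm hK hL hp hx hx0 hr0.le (by linarith)
    (by positivity) fun z hz => ?_
  have hrx : 0 < ‖r • x‖ := norm_pos_iff.2 (smul_ne_zero hr0.ne' hx0)
  have hzT : ‖z‖ ^ 2 ≤ T ^ 2 := by
    have h1 : ‖r • x + (z : E)‖ ^ 2 = ‖r • x‖ ^ 2 + ‖z‖ ^ 2 :=
      norm_add_sq_of_mem_orthogonal (L.smul_mem r hx) z.2
    have h2 : ‖r • x + (z : E)‖ ^ 2 ≤ T ^ 2 := by gcongr; exact hKT _ hz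
    nlinarith [sq_nonneg ‖r • x‖]
  rw [← Real.mul_rpow hbase.le (by positivity)]
  refine Real.rpow_le_rpow_of_nonpos (by positivity) ?_ (by linarith)
  -- scaling `x` by `r` lowers `‖x‖ ^ 2 + ‖z‖ ^ 2 ≤ 2 * T ^ 2` by at least `3 / 4 * ε ^ 2`
  have h3 : ‖r • x‖ ^ 2 ≤ 1 / 4 * ‖x‖ ^ 2 := by
    rw [norm_smul, Real.norm_of_nonneg hr0.le, mul_pow]
    gcongr
    nlinarith
  have h4 : (ε / T) ^ 2 * (‖x‖ ^ 2 + ‖z‖ ^ 2) ≤ 2 * ‖x‖ ^ 2 := by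
    have hx2 : ‖x‖ ^ 2 ≤ T ^ 2 := by gcongr
    calc (ε / T) ^ 2 * (‖x‖ ^ 2 + ‖z‖ ^ 2) ≤ (ε / T) ^ 2 * (2 * T ^ 2) := by
          gcongr; linarith
      _ = 2 * ε ^ 2 := by field_simp
      _ ≤ 2 * ‖x‖ ^ 2 := by gcongr
  nlinarith

end Splitting

/-! ### Gauges, normal cones and radial functions -/

section Gauge

variable {F : Type*} [NormedAddCommGroup F] [NormedSpace ℝ F]

theorem gauge_pos_of_isCompact {M : Set F} (hM : IsCompact M) (h0 : M ∈ nhds 0) {w : F}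
    (hw : w ≠ 0) : 0 < gauge M w :=
  (gauge_pos (absorbent_nhds_zero h0) ((NormedSpace.isVonNBounded_iff ℝ).2 hM.isBounded)).2 hw

theorem smul_mem_iff_le_inv_gauge {M : Set F} (hM : IsCompact M) (hMc : Convex ℝ M)
    (h0 : M ∈ nhds 0) {w : F} (hw : w ≠ 0) {r : ℝ} (hr : 0 ≤ r) :
    r • w ∈ M ↔ r ≤ (gauge M w)⁻¹ := by
  rw [← hM.isClosed.closure_eq, ← gauge_le_one_iff_mem_closure hMc h0, hM.isClosed.closure_eq,
    gauge_smul_of_nonneg hr, smul_eq_mul, ← one_div,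
    le_div_iff₀ (gauge_pos_of_isCompact hM h0 hw)]

end Gauge

section NormalCone

variable {E : Type*} [NormedAddCommGroup E] [InnerProductSpace ℝ E]

/-- The cone over the boundary points of `K` that have an outer unit normal vector in `L`, for a
convex set `K` with the origin in its interior. The gauge of `K` takes the place of normalizing
`x` to a boundary point. -/
def normalCone (K : Set E) (L : Submodule ℝ E) : Set E :=
  {x | ∃ v ∈ L, ‖v‖ = 1 ∧ ∀ y ∈ K, gauge K x * ⟪y, v⟫ ≤ ⟪x, v⟫}

theorem smul_mem_normalCone_iff {K : Set E} {L : Submodule ℝ E} {r : ℝ} (hr : 0 < r) {x : E} :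
    r • x ∈ normalCone K L ↔ x ∈ normalCone K L := by
  simp only [normalCone, Set.mem_ofPred_eq, gauge_smul_of_nonneg hr.le, inner_smul_left,
    smul_eq_mul, mul_assoc, conj_trivial, mul_le_mul_iff_right₀ hr]

theorem isClosed_normalCone [FiniteDimensional ℝ E] {K : Set E} (hKc : Convex ℝ K)
    (h0 : K ∈ nhds 0) (L : Submodule ℝ E) : IsClosed (normalCone K L) := by
  have hg := continuous_gauge hKc h0
  have hZ : IsClosed {p : E × Metric.sphere (0 : E) 1 | (p.2 : E) ∈ L ∧
      ∀ y ∈ K, gauge K p.1 * ⟪y, (p.2 : E)⟫ ≤ ⟪p.1, (p.2 : E)⟫} := by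
    have hinter := (L.closed_of_finiteDimensional.preimage
        (f := fun p : E × Metric.sphere (0 : E) 1 => (p.2 : E)) (by fun_prop)).inter
      (isClosed_biInter fun (y : E) (_ : y ∈ K) =>
        isClosed_le (f := fun p : E × Metric.sphere (0 : E) 1 => gauge K p.1 * ⟪y, (p.2 : E)⟫)
          (g := fun p => ⟪p.1, (p.2 : E)⟫) (by fun_prop) (by fun_prop))
    convert hinter using 1
    ext p
    simp
  convert isClosedMap_fst_of_compactSpace _ hZ using 1
  ext x
  constructor
  · rintro ⟨v, hv, hv1, h⟩
    exact ⟨(x, ⟨v, by simpa using hv1⟩), ⟨hv, h⟩, rfl⟩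
  · rintro ⟨⟨x, v⟩, ⟨hv, h⟩, rfl⟩
    exact ⟨v, hv, by simp, h⟩

/-- A point of the normal cone whose projection to `L` lies in the projection of `K` lies in `K`:
only the projection to `L` matters for the normals in `L`. -/
theorem mem_of_mem_normalCone {K : Set E} (hKc : Convex ℝ K) (hKcl : IsClosed K)
    (h0 : K ∈ nhds 0) {L : Submodule ℝ E} {x k : E} (hx : x ∈ normalCone K L) (hk : k ∈ K)
    (hxk : x - k ∈ Lᗮ) : x ∈ K := by
  obtain ⟨v, hv, hv1, h⟩ := hx
  obtain ⟨ε, hε, hεK⟩ := Metric.nhds_basis_closedBall.mem_iff.1 h0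
  have h1 : gauge K x * ε ≤ ⟪x, v⟫ := by
    have := h (ε • v) (hεK (by simp [norm_smul, hv1, abs_of_pos hε]))
    simpa [inner_smul_left, real_inner_self_eq_norm_sq, hv1] using this
  have h2 : ⟪x, v⟫ = ⟪k, v⟫ := by
    have := Submodule.inner_left_of_mem_orthogonal hv hxk
    rw [inner_sub_left] at this
    linarith
  have h3 := h k hk
  rw [← hKcl.closure_eq, ← gauge_le_one_iff_mem_closure hKc h0]
  by_contra! hlt
  nlinarith [mul_pos (one_pos.trans hlt) hε]

theorem notMem_normalCone_of_mem_orthogonal {K : Set E} (hK : IsCompact K) (h0 : K ∈ nhds 0)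
    {L : Submodule ℝ E} {x : E} (hx : x ∈ Lᗮ) (hx0 : x ≠ 0) : x ∉ normalCone K L := by
  rintro ⟨v, hv, hv1, h⟩
  obtain ⟨ε, hε, hεK⟩ := Metric.nhds_basis_closedBall.mem_iff.1 h0
  have h1 := h (ε • v) (hεK (by simp [norm_smul, hv1, abs_of_pos hε]))
  rw [Submodule.inner_left_of_mem_orthogonal hv hx, inner_smul_left, real_inner_self_eq_norm_sq,
    hv1] at h1
  have := mul_pos (gauge_pos_of_isCompact hK h0 hx0) hε
  norm_num at h1
  linarith

theorem exists_norm_eq_one_forall_inner_le [CompleteSpace E] {K : Set E} (hKc : Convex ℝ K)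
    (h0 : (0 : E) ∈ interior K) {x : E} (hx : x ∈ frontier K) :
    ∃ v : E, ‖v‖ = 1 ∧ ∀ y ∈ K, ⟪y, v⟫ ≤ ⟪x, v⟫ := by
  obtain ⟨f, hf⟩ := geometric_hahn_banach_open_point hKc.interior isOpen_interior hx.2
  set v := (InnerProductSpace.toDual ℝ E).symm f
  have hfv : ∀ y, f y = ⟪y, v⟫ := fun y => by
    rw [real_inner_comm, InnerProductSpace.toDual_symm_apply]
  have hv : v ≠ 0 := by
    intro hv
    have := hf 0 h0
    simp [hfv, hv] at this
  refine ⟨‖v‖⁻¹ • v, norm_smul_inv_norm hv, fun y hy => ?_⟩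
  have hy' : y ∈ closure (interior K) := by
    rw [hKc.closure_interior_eq_closure_of_nonempty_interior ⟨0, h0⟩]
    exact subset_closure hy
  have hle : f y ≤ f x :=
    closure_minimal (fun a ha => (hf a ha).le) (isClosed_le f.continuous continuous_const) hy'
  rw [inner_smul_right, inner_smul_right, ← hfv, ← hfv]
  gcongr

end NormalCone

section ConvexBody

variable {n : ℕ} {K : Set (EuclideanSpace ℝ (Fin n))}

theorem radialFun_eq_inv_gauge (hK : IsConvexBody K) (h0 : K ∈ nhds 0)
    {x : EuclideanSpace ℝ (Fin n)} (hx : x ≠ 0) : radialFun K x = (gauge K x)⁻¹ := by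
  have hpos := gauge_pos_of_isCompact hK.isCompact h0 hx
  refine IsGreatest.csSup_eq ⟨?_, fun c hc => ?_⟩
  · exact (smul_mem_iff_le_inv_gauge hK.isCompact hK.convex h0 hx (by positivity)).2 le_rfl
  · rcases le_total 0 c with h | h
    · exact (smul_mem_iff_le_inv_gauge hK.isCompact hK.convex h0 hx h).1 hc
    · exact h.trans (by positivity)

theorem radialFun_smul_mem_frontier (hK : IsConvexBody K) (h0 : K ∈ nhds 0)
    {x : EuclideanSpace ℝ (Fin n)} (hx : x ≠ 0) : radialFun K x • x ∈ frontier K := by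
  have hpos := gauge_pos_of_isCompact hK.isCompact h0 hx
  rw [← gauge_eq_one_iff_mem_frontier hK.convex h0, radialFun_eq_inv_gauge hK h0 hx,
    gauge_smul_of_nonneg (by positivity), smul_eq_mul, inv_mul_cancel₀ hpos.ne']

theorem reverseRadialGaussImage_univ (hK : IsConvexBody K)
    (h0 : (0 : EuclideanSpace ℝ (Fin n)) ∈ interior K) :
    reverseRadialGaussImage K Set.univ = Set.univ := by
  refine Set.eq_univ_of_forall fun u => ?_
  have hf := radialFun_smul_mem_frontier hK (mem_interior_iff_mem_nhds.1 h0)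
    (ne_zero_of_mem_unit_sphere u)
  obtain ⟨v, hv, h⟩ := exists_norm_eq_one_forall_inner_le hK.convex h0 hf
  exact ⟨hf, ⟨v, by simpa using hv⟩, trivial, h⟩

theorem mem_reverseRadialGaussImage_subsphere_iff (hK : IsConvexBody K) (h0 : K ∈ nhds 0)
    {L : Submodule ℝ (EuclideanSpace ℝ (Fin n))}
    (u : Metric.sphere (0 : EuclideanSpace ℝ (Fin n)) 1) :
    u ∈ reverseRadialGaussImage K (subsphere L) ↔
      (u : EuclideanSpace ℝ (Fin n)) ∈ normalCone K L := by
  have hu := ne_zero_of_mem_unit_sphere u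
  have hpos := gauge_pos_of_isCompact hK.isCompact h0 hu
  have hiff : ∀ v y : EuclideanSpace ℝ (Fin n),
      ⟪y, v⟫ ≤ ⟪radialFun K u • (u : EuclideanSpace ℝ (Fin n)), v⟫ ↔
        gauge K u * ⟪y, v⟫ ≤ ⟪(u : EuclideanSpace ℝ (Fin n)), v⟫ := fun v y => by
    rw [radialFun_eq_inv_gauge hK h0 hu, real_inner_smul_left, le_inv_mul_iff₀ hpos]
  constructor
  · rintro ⟨-, v, hv, h⟩
    exact ⟨v, hv, by simp, fun y hy => (hiff v y).1 (h y hy)⟩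
  · rintro ⟨v, hv, hv1, h⟩
    exact ⟨radialFun_smul_mem_frontier hK h0 hu, ⟨v, by simpa using hv1⟩, hv,
      fun y hy => (hiff v y).2 (h y hy)⟩

theorem continuous_radialFun (hK : IsConvexBody K) (h0 : K ∈ nhds 0) :
    Continuous fun u : Metric.sphere (0 : EuclideanSpace ℝ (Fin n)) 1 => radialFun K u := by
  have hcont : Continuous fun u : Metric.sphere (0 : EuclideanSpace ℝ (Fin n)) 1 =>
      (gauge K (u : EuclideanSpace ℝ (Fin n)))⁻¹ :=
    ((continuous_gauge hK.convex h0).comp continuous_subtype_val).inv₀ fun u =>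
      (gauge_pos_of_isCompact hK.isCompact h0 (ne_zero_of_mem_unit_sphere u)).ne'
  exact hcont.congr fun u => (radialFun_eq_inv_gauge hK h0 (ne_zero_of_mem_unit_sphere u)).symm

theorem radialFun_pos (hK : IsConvexBody K) (h0 : K ∈ nhds 0)
    {x : EuclideanSpace ℝ (Fin n)} (hx : x ≠ 0) : 0 < radialFun K x := by
  rw [radialFun_eq_inv_gauge hK h0 hx]
  exact inv_pos.2 (gauge_pos_of_isCompact hK.isCompact h0 hx)

end ConvexBody

/-! ### The concentration inequality for volume integrals -/

/-- Lower bound for a radial integral of a function that is at least `a` up to the radius `R` and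
at least `κ * a` up to the radius `R / 2`. -/
theorem mul_le_setLIntegral_Ioi_pow_mul {k : ℕ} (hk : 0 < k) {R κ : ℝ} (hR : 0 ≤ R) (hκ : 1 ≤ κ)
    {a : ℝ≥0∞} {g : ℝ → ℝ≥0∞} (h1 : ∀ r, 0 < r → r ≤ R → a ≤ g r)
    (h2 : ∀ r, 0 < r → r ≤ R / 2 → ENNReal.ofReal κ * a ≤ g r) :
    ENNReal.ofReal ((1 + (κ - 1) / 2 ^ k) / k * R ^ (k : ℝ)) * a ≤
      ∫⁻ r in Set.Ioi (0 : ℝ), ENNReal.ofReal (r ^ (k - 1)) * g r := by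
  have hk' : (0 : ℝ) < k := by exact_mod_cast hk
  have hpow : ∀ S : ℝ, 0 ≤ S →
      ∫⁻ r in Set.Ioc 0 S, ENNReal.ofReal (r ^ (k - 1)) = ENNReal.ofReal (S ^ (k : ℝ) / k) := by
    intro S hS
    rw [← lintegral_Ioc_rpow hk' hS]
    refine setLIntegral_congr_fun measurableSet_Ioc fun r _ => ?_
    rw [← Real.rpow_natCast, Nat.cast_pred hk]
  have hm : Measurable fun r : ℝ => ENNReal.ofReal (r ^ (k - 1)) := by fun_prop
  calc _ = (∫⁻ r in Set.Ioc 0 R, ENNReal.ofReal (r ^ (k - 1)) * a) +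
        ∫⁻ r in Set.Ioc 0 (R / 2), ENNReal.ofReal (r ^ (k - 1)) * (ENNReal.ofReal (κ - 1) * a) := by
        rw [lintegral_mul_const _ hm, lintegral_mul_const _ hm, hpow R hR,
          hpow (R / 2) (by positivity), ← mul_assoc, ← ENNReal.ofReal_mul (by positivity),
          ← add_mul, ← ENNReal.ofReal_add (by positivity)
            (mul_nonneg (by positivity) (sub_nonneg.2 hκ)), Real.div_rpow hR (by norm_num)]
        congr 2
        rw [Real.rpow_natCast, Real.rpow_natCast]
        field_simp
    _ = ∫⁻ r in Set.Ioc 0 R, (ENNReal.ofReal (r ^ (k - 1)) * a +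
          (Set.Ioc 0 (R / 2)).indicator (fun r =>
            ENNReal.ofReal (r ^ (k - 1)) * (ENNReal.ofReal (κ - 1) * a)) r) := by
        rw [lintegral_add_left (hm.mul_const _), setLIntegral_indicator measurableSet_Ioc,
          Set.inter_eq_left.2 (Set.Ioc_subset_Ioc_right (by linarith))]
    _ ≤ ∫⁻ r in Set.Ioc 0 R, ENNReal.ofReal (r ^ (k - 1)) * g r := by
        refine setLIntegral_mono' measurableSet_Ioc fun r hr => ?_
        by_cases hr2 : r ≤ R / 2
        · rw [Set.indicator_of_mem (Set.mem_Ioc.2 ⟨hr.1, hr2⟩), ← mul_add]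
          gcongr
          refine le_trans (le_of_eq ?_) (h2 r hr.1 hr2)
          nth_rw 1 [← one_mul a]
          rw [← add_mul, ← ENNReal.ofReal_one, ← ENNReal.ofReal_add zero_le_one (by linarith)]
          congr 2
          ring
        · rw [Set.indicator_of_notMem fun h : r ∈ Set.Ioc 0 (R / 2) => hr2 h.2, add_zero]
          gcongr
          exact h1 r hr.1 hr.2
    _ ≤ _ := lintegral_mono_set Set.Ioc_subset_Ioi_self

theorem measurable_indicator_norm_rpow {E : Type*} [NormedAddCommGroup E] [MeasurableSpace E]
    [BorelSpace E] {K : Set E} (hK : MeasurableSet K) (p : ℝ) :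
    Measurable (K.indicator fun w => ENNReal.ofReal (‖w‖ ^ p)) :=
  Measurable.indicator (by fun_prop) hK

section Concentration

variable {E : Type*} [NormedAddCommGroup E] [InnerProductSpace ℝ E] [FiniteDimensional ℝ E]
  [MeasurableSpace E] [BorelSpace E]

theorem measurable_fiberIntegral {K : Set E} (hK : MeasurableSet K) (L : Submodule ℝ E) (p : ℝ) :
    Measurable fun y : L => fiberIntegral K L p y :=
  Measurable.lintegral_prod_right' (f := fun q : L × Lᗮ =>
    K.indicator (fun w => ENNReal.ofReal (‖w‖ ^ p)) (q.1 + q.2))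
    ((measurable_indicator_norm_rpow hK p).comp (by fun_prop))

/-- The fibre integral of a cone is homogeneous. -/
theorem fiberIntegral_smul_of_cone {D : Set E} (hD : MeasurableSet D)
    (hcone : ∀ r : ℝ, 0 < r → ∀ x, r • x ∈ D ↔ x ∈ D) (L : Submodule ℝ E) (p : ℝ) (y : E) {r : ℝ}
    (hr : 0 < r) :
    fiberIntegral D L p (r • y) =
      ENNReal.ofReal (r ^ (p + Module.finrank ℝ Lᗮ)) * fiberIntegral D L p y := by
  have hm : Measurable fun z : Lᗮ =>
      D.indicator (fun w => ENNReal.ofReal (‖w‖ ^ p)) (r • y + z) :=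
    (measurable_indicator_norm_rpow hD p).comp (by fun_prop)
  unfold fiberIntegral
  rw [lintegral_comp_smul_of_pos volume hm hr, ← lintegral_const_mul' _ _ ENNReal.ofReal_ne_top,
    ← lintegral_const_mul' _ _ ENNReal.ofReal_ne_top]
  refine lintegral_congr fun z => ?_
  have heq : r • y + ((r • z : Lᗮ) : E) = r • (y + (z : E)) := by
    rw [Submodule.coe_smul, smul_add]
  rw [heq]
  by_cases h : y + (z : E) ∈ D
  · rw [Set.indicator_of_mem ((hcone r hr _).2 h), Set.indicator_of_mem h, norm_smul,
      Real.norm_of_nonneg hr.le, ← ENNReal.ofReal_mul (by positivity),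
      ← ENNReal.ofReal_mul (by positivity), Real.mul_rpow hr.le (norm_nonneg _),
      Real.rpow_add hr, Real.rpow_natCast]
    congr 1
    ring
  · rw [Set.indicator_of_notMem fun h' => h ((hcone r hr _).1 h'), Set.indicator_of_notMem h,
      mul_zero, mul_zero]

variable {Γ : Set (E →ₗᵢ[ℝ] E)} {K : Set E} {L : Submodule ℝ E}

/-- The subspace concentration inequality in terms of volume integrals, in arbitrary dimension.
In polar coordinates on `L`, the cone over the normals in `L` contributes along the ray spanned by
`w` a multiple of `∫ r ^ (p + dim E - 1)`, because its fibre integrals are homogeneous, whereas `K`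
contributes at least the same multiple of `∫ r ^ (dim L - 1)`, because its fibre integrals do not
decrease towards the origin. -/
theorem exists_mul_lintegral_normalCone_le
    (hΓ : ∀ S : Set E, Convex ℝ S → S.Nonempty → (∀ g ∈ Γ, ∀ x ∈ S, g x ∈ S) → (0 : E) ∈ S)
    (hKc : Convex ℝ K) (hKcomp : IsCompact K) (h0 : K ∈ nhds 0)
    (hK : ∀ g ∈ Γ, ∀ x ∈ K, g x ∈ K) (hL : ∀ g ∈ Γ, L.map g.toLinearMap = L) (hL0 : L ≠ ⊥)
    {p : ℝ} (hp : p ≤ 0) (hpn : 0 < p + Module.finrank ℝ E) :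
    ∃ C : ℝ, 1 ≤ C ∧ (p < 0 → 1 < C) ∧
      ENNReal.ofReal (C * ((p + Module.finrank ℝ E) / Module.finrank ℝ L)) *
          ∫⁻ x, (K ∩ normalCone K L).indicator (fun w => ENNReal.ofReal (‖w‖ ^ p)) x ≤
        ∫⁻ x, K.indicator (fun w => ENNReal.ofReal (‖w‖ ^ p)) x := by
  have hnt : Nontrivial L := Submodule.nontrivial_iff_ne_bot.2 hL0
  have hk : 0 < Module.finrank ℝ L := Module.finrank_pos
  have hdim : (Module.finrank ℝ L : ℝ) + Module.finrank ℝ Lᗮ = Module.finrank ℝ E := by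
    exact_mod_cast L.finrank_add_finrank_orthogonal
  set k := Module.finrank ℝ L
  have hk' : (0 : ℝ) < k := by exact_mod_cast hk
  set q : ℝ := p + Module.finrank ℝ E with hq
  have hKm : MeasurableSet K := hKcomp.isClosed.measurableSet
  have hDm : MeasurableSet (normalCone K L) := (isClosed_normalCone hKc h0 L).measurableSet
  -- the projection `M` of `K` to `L`
  let P : E →L[ℝ] L := L.orthogonalProjectionOnto
  have hPy : ∀ y : L, P y = y := fun y => L.orthogonalProjectionOnto_mem_subspace_eq_self y
  let M : Set L := P '' K
  have hMcomp : IsCompact M := hKcomp.image P.continuous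
  have hMc : Convex ℝ M := hKc.linear_image P.toLinearMap
  have hM0 : M ∈ nhds 0 := by
    have : (fun y : L => (y : E)) ⁻¹' K ∈ nhds (0 : L) :=
      continuous_subtype_val.continuousAt.preimage_mem_nhds (by simpa using h0)
    exact Filter.mem_of_superset this fun y hy => ⟨y, hy, hPy y⟩
  have hMm : MeasurableSet M := hMcomp.isClosed.measurableSet
  have hmemM : ∀ {y : L} {z : Lᗮ}, (y : E) + z ∈ K → y ∈ M := fun {y z} h =>
    ⟨_, h, by
      have : P (z : E) = 0 := L.orthogonalProjectionOnto_eq_zero_iff.2 z.2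
      rw [map_add, this, hPy, add_zero]⟩
  have hDK : ∀ {y : L} {z : Lᗮ}, y ∈ M → (y : E) + z ∈ normalCone K L → (y : E) + z ∈ K := by
    rintro y z ⟨x, hx, rfl⟩ h
    refine mem_of_mem_normalCone hKc hKcomp.isClosed h0 h hx ?_
    have h1 : x - P x ∈ Lᗮ := L.sub_starProjection_mem_orthogonal x
    have h2 : (P x : E) + z - x = z - (x - P x) := by abel
    rw [h2]
    exact Lᗮ.sub_mem z.2 h1
  -- the radius `R w` of `M` in the direction `w`
  let R : L → ℝ := fun w => (gauge M w)⁻¹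
  have hRpos : ∀ w : L, w ≠ 0 → 0 < R w := fun w hw =>
    inv_pos.2 (gauge_pos_of_isCompact hMcomp hM0 hw)
  have hR : ∀ w : L, w ≠ 0 → ∀ r : ℝ, 0 ≤ r → (r • w ∈ M ↔ r ≤ R w) := fun w hw r hr =>
    smul_mem_iff_le_inv_gauge hMcomp hMc hM0 hw hr
  obtain ⟨ε, hε, hεM⟩ := Metric.nhds_basis_closedBall.mem_iff.1 hM0
  obtain ⟨T, hT⟩ := hKcomp.isBounded.exists_norm_le
  have hMT : ∀ y ∈ M, ‖y‖ ≤ T := by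
    rintro _ ⟨x, hx, rfl⟩
    exact (L.norm_orthogonalProjectionOnto_apply_le x).trans (hT x hx)
  have hεT : ε ≤ T := by
    obtain ⟨w, hw⟩ := exists_norm_eq L hε.le
    exact hw ▸ hMT w (hεM (by simp [hw]))
  have hT0 : 0 < T := hε.trans_le hεT
  set κ : ℝ := (1 - 3 / 8 * (ε / T) ^ 2) ^ (p / 2)
  have hsq : (ε / T) ^ 2 ≤ 1 := by
    rw [sq_le_one_iff₀ (by positivity), div_le_one hT0]
    exact hεT
  have hsq0 : 0 < (ε / T) ^ 2 := by positivity
  have hκ : 1 ≤ κ := Real.one_le_rpow_of_pos_of_le_one_of_nonpos (by linarith) (by linarith)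
    (by linarith)
  obtain ⟨c, hc⟩ := exists_lintegral_eq_lintegral_orthogonal L
  refine ⟨1 + (κ - 1) / 2 ^ k, ?_, fun hp0 => ?_, ?_⟩
  · have : 0 ≤ (κ - 1) / 2 ^ k := div_nonneg (sub_nonneg.2 hκ) (by positivity)
    linarith
  · have : 1 < κ := Real.one_lt_rpow_of_pos_of_lt_one_of_neg (by linarith) (by linarith)
      (by linarith)
    have : 0 < (κ - 1) / 2 ^ k := div_pos (sub_pos.2 this) (by positivity)
    linarith
  have hCpos : 0 ≤ 1 + (κ - 1) / 2 ^ k := by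
    have : 0 ≤ (κ - 1) / 2 ^ k := div_nonneg (sub_nonneg.2 hκ) (by positivity)
    linarith
  -- the common radial integral of the fibre integrals of the cone
  let I : ℝ≥0∞ := ∫⁻ w : Metric.sphere (0 : L) 1,
    ENNReal.ofReal (R w ^ q / q) * fiberIntegral (normalCone K L) L p w
      ∂(volume : Measure L).toSphere
  have hupper : ∫⁻ x, (K ∩ normalCone K L).indicator (fun w => ENNReal.ofReal (‖w‖ ^ p)) x ≤
      c * I := by
    rw [hc _ (measurable_indicator_norm_rpow (hKm.inter hDm) p)]
    gcongr
    calc _ ≤ ∫⁻ y : L, M.indicator (fun y : L => fiberIntegral (normalCone K L) L p y) y := by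
          refine lintegral_mono fun y => ?_
          by_cases hy : y ∈ M
          · rw [Set.indicator_of_mem hy]
            exact lintegral_mono fun z =>
              Set.indicator_le_indicator_of_subset Set.inter_subset_right (fun _ => bot_le) _
          · rw [Set.indicator_of_notMem hy]
            refine (lintegral_eq_zero_of_ae_eq_zero (.of_forall fun z => ?_)).le
            exact Set.indicator_of_notMem (fun h => hy (hmemM h.1)) _
      _ = I := by
          rw [Measure.lintegral_eq_lintegral_toSphere volume
            ((measurable_fiberIntegral hDm L p).indicator hMm)]
          refine lintegral_congr fun w => ?_
          have hw := ne_zero_of_mem_unit_sphere w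
          rw [← lintegral_Ioc_rpow hpn (hRpos w hw).le, ← lintegral_mul_const _ (by fun_prop)]
          have hsub : Set.Ioc 0 (R w) ∩ Set.Ioi 0 = Set.Ioc 0 (R w) :=
            Set.inter_eq_left.2 Set.Ioc_subset_Ioi_self
          rw [← hsub, ← setLIntegral_indicator measurableSet_Ioc]
          refine setLIntegral_congr_fun measurableSet_Ioi fun r (hr : 0 < r) => ?_
          by_cases hrR : r ≤ R w
          · rw [Set.indicator_of_mem ((hR w hw r hr.le).2 hrR),
              Set.indicator_of_mem (Set.mem_Ioc.2 ⟨hr, hrR⟩),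
              Submodule.coe_smul, fiberIntegral_smul_of_cone hDm
                (fun r hr x => smul_mem_normalCone_iff hr) L p _ hr, ← mul_assoc,
              ← ENNReal.ofReal_mul (by positivity), ← Real.rpow_natCast, ← Real.rpow_add hr,
              Nat.cast_pred hk]
            congr 3
            linarith
          · rw [Set.indicator_of_notMem fun h => hrR ((hR w hw r hr.le).1 h),
              Set.indicator_of_notMem fun h : r ∈ Set.Ioc 0 (R w) => hrR h.2, mul_zero]
  have hlower : ENNReal.ofReal ((1 + (κ - 1) / 2 ^ k) * (q / k)) * (c * I) ≤
      ∫⁻ x, K.indicator (fun w => ENNReal.ofReal (‖w‖ ^ p)) x := by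
    rw [hc _ (measurable_indicator_norm_rpow hKm p), ← mul_assoc, mul_comm _ (c : ℝ≥0∞), mul_assoc]
    gcongr
    change _ ≤ ∫⁻ y : L, fiberIntegral K L p y
    rw [Measure.lintegral_eq_lintegral_toSphere volume (measurable_fiberIntegral hKm L p),
      ← lintegral_const_mul' _ _ ENNReal.ofReal_ne_top]
    refine lintegral_mono fun w => ?_
    have hw := ne_zero_of_mem_unit_sphere w
    have hw1 : ‖(w : L)‖ = 1 := norm_eq_of_mem_sphere w
    have hRw := hRpos w hw
    set x : L := R w • (w : L) with hx
    have hxM : x ∈ M := (hR w hw _ hRw.le).2 le_rfl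
    have hxR : ‖x‖ = R w := by rw [hx, norm_smul, hw1, Real.norm_of_nonneg hRw.le, mul_one]
    have hεx : ε ≤ ‖(x : E)‖ := by
      have : ε • (w : L) ∈ M := hεM (by simp [norm_smul, hw1, abs_of_pos hε])
      exact ((hR w hw ε hε.le).1 this).trans_eq hxR.symm
    have hx0 : (x : E) ≠ 0 := norm_pos_iff.1 (hε.trans_le hεx)
    have hle : fiberIntegral (normalCone K L) L p x ≤ fiberIntegral K L p x := by
      refine lintegral_mono fun z => ?_
      by_cases hz : (x : E) + z ∈ normalCone K L
      · rw [Set.indicator_of_mem hz, Set.indicator_of_mem (hDK hxM hz)]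
      · rw [Set.indicator_of_notMem hz]
        exact bot_le
    have hscale : ∀ r : ℝ, ((r • (w : L) : L) : E) = (r / R w) • (x : E) := fun r => by
      rw [← Submodule.coe_smul, hx, smul_smul, div_mul_cancel₀ _ hRw.ne']
    have hrad := mul_le_setLIntegral_Ioi_pow_mul hk hRw.le hκ (a := fiberIntegral K L p x)
      (g := fun r => fiberIntegral K L p ((r • (w : L) : L) : E))
      (fun r hr hrR => by
        rw [hscale r]
        exact fiberIntegral_le_fiberIntegral_smul hΓ hKc hKm hK hL hp x.2 hx0 (by positivity)
          ((div_le_one hRw).2 hrR))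
      (fun r hr hrR => by
        rw [hscale r]
        refine mul_fiberIntegral_le_fiberIntegral_smul_of_le_half hΓ hKc hKm hK hL hp x.2 hε hεx
          (hMT x hxM) hT (by positivity) ?_
        rw [div_le_iff₀ hRw]
        linarith)
    refine le_trans ?_ hrad
    calc _ = ENNReal.ofReal ((1 + (κ - 1) / 2 ^ k) / k * R w ^ (k : ℝ)) *
          fiberIntegral (normalCone K L) L p x := by
          rw [hx, Submodule.coe_smul, fiberIntegral_smul_of_cone hDm
            (fun r hr x => smul_mem_normalCone_iff hr) L p _ hRw, ← mul_assoc, ← mul_assoc,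
            ← ENNReal.ofReal_mul (by positivity), ← ENNReal.ofReal_mul (by positivity),
            mul_assoc (_ / (k : ℝ)),
            ← Real.rpow_add hRw]
          have : (k : ℝ) + (p + Module.finrank ℝ Lᗮ) = q := by linarith
          rw [this]
          congr 2
          field_simp
      _ ≤ _ := by gcongr
  refine le_trans ?_ hlower
  gcongr

end Concentration

/-! ### The dual curvature measure -/

section DualCurvature

variable {n : ℕ} {K : Set (EuclideanSpace ℝ (Fin n))}

/-- The spherical integral defining the dual curvature measure, over the directions of a cone, is a
weighted volume of the part of `K` in the cone. -/
theorem setLIntegral_radialFun_rpow (hn : 0 < n) (hK : IsConvexBody K) (h0 : K ∈ nhds 0) {q : ℝ}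
    (hq : 0 < q) {D : Set (EuclideanSpace ℝ (Fin n))} (hD : MeasurableSet D)
    (hcone : ∀ r : ℝ, 0 < r → ∀ x, r • x ∈ D ↔ x ∈ D) :
    ∫⁻ u in {u : Metric.sphere (0 : EuclideanSpace ℝ (Fin n)) 1 |
        (u : EuclideanSpace ℝ (Fin n)) ∈ D},
        ENNReal.ofReal (radialFun K u ^ q) ∂(volume : Measure (EuclideanSpace ℝ (Fin n))).toSphere =
      ENNReal.ofReal q * ∫⁻ x, (K ∩ D).indicator (fun w => ENNReal.ofReal (‖w‖ ^ (q - n))) x := by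
  have hne : NeZero n := ⟨hn.ne'⟩
  have hKm : MeasurableSet K := hK.isCompact.isClosed.measurableSet
  have hDs : MeasurableSet {u : Metric.sphere (0 : EuclideanSpace ℝ (Fin n)) 1 |
      (u : EuclideanSpace ℝ (Fin n)) ∈ D} := measurable_subtype_coe hD
  rw [Measure.lintegral_eq_lintegral_toSphere volume
      (measurable_indicator_norm_rpow (hKm.inter hD) (q - n)),
    ← lintegral_const_mul' _ _ ENNReal.ofReal_ne_top, ← lintegral_indicator hDs]
  refine lintegral_congr fun u => ?_
  have hu := ne_zero_of_mem_unit_sphere u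
  have hu1 : ‖(u : EuclideanSpace ℝ (Fin n))‖ = 1 := norm_eq_of_mem_sphere u
  have hρ := radialFun_pos hK h0 hu
  have hmem : ∀ r : ℝ, 0 < r →
      (r • (u : EuclideanSpace ℝ (Fin n)) ∈ K ↔ r ≤ radialFun K u) := fun r hr => by
    rw [radialFun_eq_inv_gauge hK h0 hu]
    exact smul_mem_iff_le_inv_gauge hK.isCompact hK.convex h0 hu hr.le
  by_cases hD' : (u : EuclideanSpace ℝ (Fin n)) ∈ D
  · have hinner : ∫⁻ r in Set.Ioi (0 : ℝ),
        ENNReal.ofReal (r ^ (Module.finrank ℝ (EuclideanSpace ℝ (Fin n)) - 1)) *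
          (K ∩ D).indicator (fun w => ENNReal.ofReal (‖w‖ ^ (q - n)))
            (r • (u : EuclideanSpace ℝ (Fin n))) = ENNReal.ofReal (radialFun K u ^ q / q) := by
      have hsub : Set.Ioc 0 (radialFun K u) ∩ Set.Ioi 0 = Set.Ioc 0 (radialFun K u) :=
        Set.inter_eq_left.2 Set.Ioc_subset_Ioi_self
      rw [← lintegral_Ioc_rpow hq hρ.le, ← hsub, ← setLIntegral_indicator measurableSet_Ioc]
      refine setLIntegral_congr_fun measurableSet_Ioi fun r (hr : 0 < r) => ?_
      by_cases hrR : r ≤ radialFun K u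
      · rw [Set.indicator_of_mem (Set.mem_inter ((hmem r hr).2 hrR) ((hcone r hr _).2 hD')),
          Set.indicator_of_mem (Set.mem_Ioc.2 ⟨hr, hrR⟩), norm_smul, hu1, mul_one,
          Real.norm_of_nonneg hr.le, ← ENNReal.ofReal_mul (by positivity), ← Real.rpow_natCast,
          ← Real.rpow_add hr, finrank_euclideanSpace_fin, Nat.cast_pred hn]
        congr 2
        ring
      · rw [Set.indicator_of_notMem fun h => hrR ((hmem r hr).1 h.1),
          Set.indicator_of_notMem fun h : r ∈ Set.Ioc 0 (radialFun K u) => hrR h.2, mul_zero]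
    rw [hinner, Set.indicator_of_mem (show u ∈ {u : Metric.sphere (0 : EuclideanSpace ℝ (Fin n)) 1 |
      (u : EuclideanSpace ℝ (Fin n)) ∈ D} from hD'), ← ENNReal.ofReal_mul hq.le,
      mul_div_cancel₀ _ hq.ne']
  · rw [Set.indicator_of_notMem (show u ∉ {u : Metric.sphere (0 : EuclideanSpace ℝ (Fin n)) 1 |
      (u : EuclideanSpace ℝ (Fin n)) ∈ D} from hD')]
    have hzero : ∀ r ∈ Set.Ioi (0 : ℝ),
        ENNReal.ofReal (r ^ (Module.finrank ℝ (EuclideanSpace ℝ (Fin n)) - 1)) *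
          (K ∩ D).indicator (fun w => ENNReal.ofReal (‖w‖ ^ (q - n)))
            (r • (u : EuclideanSpace ℝ (Fin n))) = 0 := fun r hr => by
      rw [Set.indicator_of_notMem fun h => hD' ((hcone r hr _).1 h.2), mul_zero]
    rw [setLIntegral_congr_fun measurableSet_Ioi hzero, lintegral_zero, mul_zero]

theorem dualCurvature_eq_toReal (hK : IsConvexBody K) (h0 : K ∈ nhds 0) (q : ℝ)
    (η : Set (Metric.sphere (0 : EuclideanSpace ℝ (Fin n)) 1)) :
    dualCurvature q K η = 1 / (n : ℝ) * (∫⁻ u in reverseRadialGaussImage K η,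
      ENNReal.ofReal (radialFun K u ^ q)
        ∂(volume : Measure (EuclideanSpace ℝ (Fin n))).toSphere).toReal := by
  have hpos : ∀ u : Metric.sphere (0 : EuclideanSpace ℝ (Fin n)) 1, 0 < radialFun K u :=
    fun u => radialFun_pos hK h0 (ne_zero_of_mem_unit_sphere u)
  rw [dualCurvature, integral_eq_lintegral_of_nonneg_ae
    (.of_forall fun u => Real.rpow_nonneg (hpos u).le _)]
  exact ((continuous_radialFun hK h0).rpow_const
    fun u => .inl (hpos u).ne').measurable.aestronglyMeasurable

theorem lintegral_radialFun_rpow_ne_top (hK : IsConvexBody K) (h0 : K ∈ nhds 0) (q : ℝ) :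
    ∫⁻ u : Metric.sphere (0 : EuclideanSpace ℝ (Fin n)) 1, ENNReal.ofReal (radialFun K u ^ q)
      ∂(volume : Measure (EuclideanSpace ℝ (Fin n))).toSphere ≠ ∞ := by
  have hpos : ∀ u : Metric.sphere (0 : EuclideanSpace ℝ (Fin n)) 1, 0 < radialFun K u :=
    fun u => radialFun_pos hK h0 (ne_zero_of_mem_unit_sphere u)
  have hcont : Continuous fun u : Metric.sphere (0 : EuclideanSpace ℝ (Fin n)) 1 =>
      radialFun K u ^ q := (continuous_radialFun hK h0).rpow_const fun u => .inl (hpos u).ne'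
  have hint : Integrable (fun u : Metric.sphere (0 : EuclideanSpace ℝ (Fin n)) 1 =>
      radialFun K u ^ q) (volume : Measure (EuclideanSpace ℝ (Fin n))).toSphere := by
    simpa using hcont.continuousOn.integrableOn_compact
      (μ := (volume : Measure (EuclideanSpace ℝ (Fin n))).toSphere) isCompact_univ
  exact hint.lintegral_lt_top.ne

theorem setLIntegral_radialFun_rpow_pos (hK : IsConvexBody K) (h0 : K ∈ nhds 0) (q : ℝ)
    {U : Set (Metric.sphere (0 : EuclideanSpace ℝ (Fin n)) 1)} (hU : IsOpen U)
    (hU0 : U.Nonempty) :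
    0 < ∫⁻ u in U, ENNReal.ofReal (radialFun K u ^ q)
      ∂(volume : Measure (EuclideanSpace ℝ (Fin n))).toSphere := by
  have hpos : ∀ u : Metric.sphere (0 : EuclideanSpace ℝ (Fin n)) 1, 0 < radialFun K u :=
    fun u => radialFun_pos hK h0 (ne_zero_of_mem_unit_sphere u)
  have hm : Measurable fun u : Metric.sphere (0 : EuclideanSpace ℝ (Fin n)) 1 =>
      ENNReal.ofReal (radialFun K u ^ q) :=
    ((continuous_radialFun hK h0).measurable.pow_const q).ennreal_ofReal
  have hsupp : Function.support (fun u : Metric.sphere (0 : EuclideanSpace ℝ (Fin n)) 1 =>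
      ENNReal.ofReal (radialFun K u ^ q)) = Set.univ :=
    Set.eq_univ_of_forall fun u => (ENNReal.ofReal_pos.2 (Real.rpow_pos_of_pos (hpos u) q)).ne'
  rw [setLIntegral_pos_iff hm, hsupp, Set.univ_inter]
  exact hU.measure_pos _ hU0

end DualCurvature

theorem mainTheorem5 {n : ℕ} (G : Subgroup (Matrix.orthogonalGroup (Fin n) ℝ))
    (hG : IsClosed (G : Set (Matrix.orthogonalGroup (Fin n) ℝ)))
    (hfix : NoNonzeroFixedPoints G)
    (K : Set (EuclideanSpace ℝ (Fin n))) (hK : IsConvexBody K) (hKG : IsInvariantSet G K)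
    (q : ℝ) (hq0 : 0 < q) (hqn : q ≤ n) :
    (0 : EuclideanSpace ℝ (Fin n)) ∈ interior K ∧
    0 < dualCurvature q K Set.univ ∧
    ∀ L : Submodule ℝ (EuclideanSpace ℝ (Fin n)), L ≠ ⊥ → L ≠ ⊤ → IsInvariantSubspace G L →
      dualCurvature q K (subsphere L) / dualCurvature q K Set.univ
        ≤ min ((Module.finrank ℝ L : ℝ) / q) 1 ∧
      (q < n →
        dualCurvature q K (subsphere L) / dualCurvature q K Set.univ
          < min ((Module.finrank ℝ L : ℝ) / q) 1) := by
  have h0 := zero_mem_interior_of_invariant hG hfix hK hKG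
  have h0' : K ∈ nhds 0 := mem_interior_iff_mem_nhds.1 h0
  have hn : (0 : ℝ) < n := hq0.trans_le hqn
  have hnN : 0 < n := by exact_mod_cast hn
  have hne : NeZero n := ⟨hnN.ne'⟩
  have hsphere : Nonempty (Metric.sphere (0 : EuclideanSpace ℝ (Fin n)) 1) :=
    (NormedSpace.sphere_nonempty.2 zero_le_one).to_subtype
  have hfin := lintegral_radialFun_rpow_ne_top hK h0' q
  have htot_pos := setLIntegral_radialFun_rpow_pos hK h0' q isOpen_univ Set.univ_nonempty
  have htot := setLIntegral_radialFun_rpow hnN hK h0' hq0 MeasurableSet.univ fun _ _ _ => Iff.rfl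
  rw [Measure.restrict_univ] at htot_pos
  simp only [Set.mem_univ, Set.ofPred_true, Set.inter_univ, Measure.restrict_univ] at htot
  have hb := ENNReal.toReal_pos htot_pos.ne' hfin
  have hcurv : dualCurvature q K Set.univ = 1 / (n : ℝ) * (∫⁻ u,
      ENNReal.ofReal (radialFun K u ^ q)
        ∂(volume : Measure (EuclideanSpace ℝ (Fin n))).toSphere).toReal := by
    rw [dualCurvature_eq_toReal hK h0', reverseRadialGaussImage_univ hK h0, Measure.restrict_univ]
  refine ⟨h0, ?_, fun L hL0 hL1 hLG => ?_⟩
  · rw [hcurv]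
    positivity
  have hα : reverseRadialGaussImage K (subsphere L) =
      {u : Metric.sphere (0 : EuclideanSpace ℝ (Fin n)) 1 |
        (u : EuclideanSpace ℝ (Fin n)) ∈ normalCone K L} :=
    Set.ext fun u => mem_reverseRadialGaussImage_subsphere_iff hK h0' u
  have hDcl := isClosed_normalCone hK.convex h0' L
  have hαcl : IsClosed {u : Metric.sphere (0 : EuclideanSpace ℝ (Fin n)) 1 |
      (u : EuclideanSpace ℝ (Fin n)) ∈ normalCone K L} := hDcl.preimage continuous_subtype_val
  have hpart := setLIntegral_radialFun_rpow hnN hK h0' hq0 hDcl.measurableSet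
    fun r hr x => smul_mem_normalCone_iff hr
  obtain ⟨C, hC1, hClt, hC⟩ := exists_mul_lintegral_normalCone_le
    (Γ := orthIsometry '' (G : Set (Matrix.orthogonalGroup (Fin n) ℝ))) (p := q - n)
    (fun S hS hS0 hinv => zero_mem_of_convex_invariant hG hfix hS hS0
      fun g hg x hx => hinv _ ⟨g, hg, rfl⟩ x hx)
    hK.convex hK.isCompact h0'
    (by
      rintro _ ⟨g, hg, rfl⟩ x hx
      rw [← hKG g hg]
      exact ⟨x, hx, rfl⟩)
    (by
      rintro _ ⟨g, hg, rfl⟩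
      exact hLG g hg)
    hL0 (by linarith) (by rw [finrank_euclideanSpace_fin]; linarith)
  have hdual : dualCurvature q K (subsphere L) = _ := dualCurvature_eq_toReal hK h0' q _
  rw [hα] at hdual
  have hk : (0 : ℝ) < Module.finrank ℝ L := by
    have := Submodule.one_le_finrank_iff.2 hL0
    exact_mod_cast this
  -- directions orthogonal to `L` do not belong to the cone, so it misses an open set of directions
  have hlt : ∫⁻ u in {u : Metric.sphere (0 : EuclideanSpace ℝ (Fin n)) 1 |
        (u : EuclideanSpace ℝ (Fin n)) ∈ normalCone K L}, ENNReal.ofReal (radialFun K u ^ q)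
          ∂(volume : Measure (EuclideanSpace ℝ (Fin n))).toSphere <
      ∫⁻ u, ENNReal.ofReal (radialFun K u ^ q)
        ∂(volume : Measure (EuclideanSpace ℝ (Fin n))).toSphere := by
    obtain ⟨x, hx, hx0⟩ := Submodule.exists_mem_ne_zero_of_ne_bot
      (mt L.orthogonal_eq_bot_iff.1 hL1)
    have hcompl := setLIntegral_radialFun_rpow_pos hK h0' q hαcl.isOpen_compl
      ⟨⟨‖x‖⁻¹ • x, by simp [norm_smul, hx0]⟩, notMem_normalCone_of_mem_orthogonal hK.isCompact h0'
        (Lᗮ.smul_mem _ hx) (by simp [hx0])⟩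
    exact (ENNReal.lt_add_right (ne_top_of_le_ne_top hfin (setLIntegral_le_lintegral _ _))
      hcompl.ne').trans_eq (lintegral_add_compl _ hαcl.measurableSet)
  have hmul : ENNReal.ofReal (C * (q / Module.finrank ℝ L)) *
      ∫⁻ u in {u : Metric.sphere (0 : EuclideanSpace ℝ (Fin n)) 1 |
        (u : EuclideanSpace ℝ (Fin n)) ∈ normalCone K L}, ENNReal.ofReal (radialFun K u ^ q)
          ∂(volume : Measure (EuclideanSpace ℝ (Fin n))).toSphere ≤
      ∫⁻ u, ENNReal.ofReal (radialFun K u ^ q)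
        ∂(volume : Measure (EuclideanSpace ℝ (Fin n))).toSphere := by
    rw [finrank_euclideanSpace_fin, sub_add_cancel] at hC
    rw [hpart, htot, mul_left_comm]
    gcongr
  rw [hdual, hcurv, mul_div_mul_left _ _ (by positivity : (1 / (n : ℝ)) ≠ 0)]
  have hreal := ENNReal.toReal_mono hfin hmul
  rw [ENNReal.toReal_mul, ENNReal.toReal_ofReal (by positivity)] at hreal
  have hltr := ENNReal.toReal_strict_mono hfin hlt
  set a := (∫⁻ u in {u : Metric.sphere (0 : EuclideanSpace ℝ (Fin n)) 1 |
        (u : EuclideanSpace ℝ (Fin n)) ∈ normalCone K L}, ENNReal.ofReal (radialFun K u ^ q)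
          ∂(volume : Measure (EuclideanSpace ℝ (Fin n))).toSphere).toReal
  set b := (∫⁻ u, ENNReal.ofReal (radialFun K u ^ q)
        ∂(volume : Measure (EuclideanSpace ℝ (Fin n))).toSphere).toReal
  have ha0 : 0 ≤ a := ENNReal.toReal_nonneg
  have hone : a / b < 1 := (div_lt_one hb).2 hltr
  have hscaled : C * (a / b) ≤ (Module.finrank ℝ L : ℝ) / q := by
    rw [← mul_div_assoc, div_le_div_iff₀ hb hq0]
    calc C * a * q = C * (q / Module.finrank ℝ L) * a * Module.finrank ℝ L := by field_simp
      _ ≤ b * Module.finrank ℝ L := by gcongr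
      _ = _ := mul_comm _ _
  have hab : 0 ≤ a / b := by positivity
  refine ⟨le_min ((le_mul_of_one_le_left hab hC1).trans hscaled) hone.le,
    fun hqn' => lt_min ?_ hone⟩
  rcases hab.eq_or_lt with h | h
  · rw [← h]
    positivity
  · exact (lt_mul_of_one_lt_left h (hClt (by linarith))).trans_le hscaled
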